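/- Let $1\le k\le n$ be integers and $p\in[0,1]$. Let $A(n,k,p)$ be the set of probability measures $\mathbf P$ on $\{0,1\}^n$ under which the coordinates $X_1,\dots,X_n$ are Bernoulli random variables with mean $p$ and every $k$ of them are independent; let $M(n,k,p)=\max_{\mathbf P\in A(n,k,p)}\mathbf P(X_1=\cdots=X_n=1)$, and call $\mathbf P\in A(n,k,p)$ optimizing if it attains this maximum. The law $\mathbf P$ is exchangeable if $\mathbf P(X_{i_1}=\cdots=X_{i_t}=1)$ depends only on $t$ for $i_1<\cdots<i_t$; put $v_i=\mathbf P(X_1=\cdots=X_i=1,\ X_{i+1}=\cdots=X_n=0)$, $0\le i\le n$. For integers $m\ge 0$ and $l$ let $B(m,l,x)=\sum_{j=0}^{l}(-1)^j\binom mj x^j$, with $B(m,l,x)=0$ for $l<0$. Let $k$ be even, $2\le k\le n-2$, and put $\overline p_1=1-\frac1{n-k+1}$ and $I=\{n-k-1,\,n-k,\,n-k+2,\dots,n-1,n\}$. 1. There is $\overline p_2<\overline p_1$ such that for all $p\in[\overline p_2,\overline p_1]$ $$M(n,k,p)=B(n,k,1-p)+\frac{\binom n{k+1}}{\binom{n-k+1}2}(1-p)^{k-1}B(n-k+1,1,1-p),\qquad(\ast)$$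 and there is an exchangeable optimizing law, which is unique and is given for $0\le i\le n$ by $$v_{n-i}=\begin{cases}(1-p)^iB(n-i,k-i,1-p)-(-1)^{k-i-1}\dfrac{\binom{n-i}{k+1-i}}{\binom{n-k+1}2}(1-p)^{k-1}B(n-k+1,1,1-p),& n-i\in I,\\[2mm] 0,& n-i\notin I.\end{cases}\qquad(\ast\ast)$$ 2. The smallest $\overline p_2<\overline p_1$ such that $(\ast)$ and $(\ast\ast)$ hold for all $p\in[\overline p_2,\overline p_1]$ is: for $k=2$, $\overline p_2=1-\frac2{n-1}$; for $k\ge4$, the zero, which is unique, of $$1-\binom{n-k+3}1(1-p)+\frac56\binom{n-k+3}2(1-p)^2-\frac12\binom{n-k+3}3(1-p)^3$$ in the interval $\left[1-\frac2{n-k+1},\,1-\frac1{n-k+1}\right]$. -/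

import Mathlib

open MeasureTheory ProbabilityTheory

noncomputable section

/-- A law of `n` random bits: a probability measure on `{0,1}^n`. The `i`-th bit `X_i` is the
coordinate `ω ↦ ω i`, with `true` for `1` and `false` for `0`. -/
abbrev BitLaw (n : ℕ) : Type := ProbabilityMeasure (Fin n → Bool)

/-- The event that all the bits with index in `S` are equal to `1`. -/
def onesOn {n : ℕ} (S : Finset (Fin n)) : Set (Fin n → Bool) :=
  {ω | ∀ i ∈ S, ω i = true}

/-- `A(n,k,p)`: the laws under which every bit is Bernoulli with mean `p` and every `k` of the
bits are independent. -/
def kWiseLaws (n k : ℕ) (p : ℝ) : Set (BitLaw n) :=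
  {P | (∀ i : Fin n, (P : Measure (Fin n → Bool)).real {ω | ω i = true} = p) ∧
    ∀ S : Finset (Fin n), S.card = k →
      iIndepFun (fun (i : S) (ω : Fin n → Bool) => ω (i : Fin n)) (P : Measure (Fin n → Bool))}

/-- The probability `P(X_1 = ⋯ = X_n = 1)`. -/
def probAllOnes {n : ℕ} (P : BitLaw n) : ℝ :=
  (P : Measure (Fin n → Bool)).real {ω | ∀ i, ω i = true}

/-- `M(n,k,p)`: the maximum of `P(X_1 = ⋯ = X_n = 1)` over `P ∈ A(n,k,p)`. -/
def maxAllOnes (n k : ℕ) (p : ℝ) : ℝ :=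
  sSup (probAllOnes '' kWiseLaws n k p)

/-- `P` is an optimizing measure for `(n,k,p)`. -/
def IsOptimizing (n k : ℕ) (p : ℝ) (P : BitLaw n) : Prop :=
  P ∈ kWiseLaws n k p ∧ probAllOnes P = maxAllOnes n k p

/-- The bits are exchangeable under `P`: the probability that a given set of bits are all `1`
depends only on the size of the set. -/
def Exchangeable {n : ℕ} (P : BitLaw n) : Prop :=
  ∀ S T : Finset (Fin n), S.card = T.card →
    (P : Measure (Fin n → Bool)).real (onesOn S) = (P : Measure (Fin n → Bool)).real (onesOn T)

/-- `v_i`: the probability that the first `i` bits are `1` and the remaining ones are `0`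
(`Fin n` counts from `0`). -/
def atomProb {n : ℕ} (P : BitLaw n) (i : ℕ) : ℝ :=
  (P : Measure (Fin n → Bool)).real
    {ω | ∀ j : Fin n, ((j : ℕ) < i → ω j = true) ∧ (i ≤ (j : ℕ) → ω j = false)}

/-- The Bonferroni polynomial `B(m,l,x) = ∑_{j=0}^{l} (-1)^j (m choose j) x^j`, which is `0` for
negative `l`. -/
def bonferroni (m : ℕ) (l : ℤ) (x : ℝ) : ℝ :=
  ∑ j ∈ Finset.range (l + 1).toNat, (-1) ^ j * (m.choose j : ℝ) * x ^ j

/-- The polynomial giving `M(n,k,p)` on the second to last interval. -/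
def secondLastValue (n k : ℕ) (p : ℝ) : ℝ :=
  bonferroni n k (1 - p) +
    (n.choose (k + 1) : ℝ) / ((n - k + 1).choose 2 : ℝ) * (1 - p) ^ (k - 1) *
      bonferroni (n - k + 1) 1 (1 - p)

/-- The index set `I = {n-k-1, n-k, n-k+2, …, n-1, n}`. -/
def secondLastSupport (n k : ℕ) : Finset ℕ :=
  {n - k - 1, n - k} ∪ Finset.Icc (n - k + 2) n

/-- The value prescribed for `v_{n-i}`, `0 ≤ i ≤ n`. On the support `i ≤ k + 1`; the sign
`(-1)^(k-i-1)` is written `(-1)^(k+i+1)`, since `k - i - 1` may be negative. -/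
def secondLastAtom (n k : ℕ) (p : ℝ) (i : ℕ) : ℝ :=
  if n - i ∈ secondLastSupport n k then
    (1 - p) ^ i * bonferroni (n - i) ((k : ℤ) - (i : ℤ)) (1 - p) -
      (-1) ^ (k + i + 1) *
        (((n - i).choose (k + 1 - i) : ℝ) / ((n - k + 1).choose 2 : ℝ)) *
        (1 - p) ^ (k - 1) * bonferroni (n - k + 1) 1 (1 - p)
  else 0

/-- The two assertions at a point `p`: `M(n,k,p)` has the stated value, and the optimizing
exchangeable distribution (it exists and is unique) is the stated one. -/
def SecondLastFormulas (n k : ℕ) (p : ℝ) : Prop :=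
  maxAllOnes n k p = secondLastValue n k p ∧
  (∃ P : BitLaw n, Exchangeable P ∧ IsOptimizing n k p P) ∧
  ∀ P : BitLaw n, Exchangeable P → IsOptimizing n k p P →
    ∀ i ≤ n, atomProb P (n - i) = secondLastAtom n k p i

/-- The right endpoint `1 - 1/(n-k+1)` of the second to last interval. -/
def pBarOne (n k : ℕ) : ℝ := 1 - 1 / ((n : ℝ) - (k : ℝ) + 1)

/-- The admissible left endpoints: the `q < 1 - 1/(n-k+1)` such that both formulas hold at every
`p ∈ [q, 1 - 1/(n-k+1)]`. -/
def secondLastEndpoints (n k : ℕ) : Set ℝ :=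
  {q | q < pBarOne n k ∧ ∀ p ∈ Set.Icc q (pBarOne n k), SecondLastFormulas n k p}

/-- The cubic `1 - (N choose 1) x + (5/6) (N choose 2) x^2 - (1/2) (N choose 3) x^3`, where
`N = n - k + 3`. -/
def intervalCubic (n k : ℕ) (x : ℝ) : ℝ :=
  1 - ((n - k + 3).choose 1 : ℝ) * x + 5 / 6 * ((n - k + 3).choose 2 : ℝ) * x ^ 2 -
    1 / 2 * ((n - k + 3).choose 3 : ℝ) * x ^ 3

end

/-! The argument is linear programming duality in the number `Z` of zeros. Independence of every `k`
bits fixes `E[C(Z, j)]` for `j ≤ k`, hence the mean of every polynomial of degree at most `k` in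
`Z`. Take `g(z) = ∏ (z - a)` over `a ∈ {1, …, k-2, k, k+1}`. For even `k` it has degree `k`,
vanishes at these points and is positive at all other naturals, so `P(Z = 0) g(0) ≤ E[g(Z)]`, where
the right side is the same for all admissible laws. Equality forces `Z` into the `k + 1` points `{0,
…, k-2, k, k+1}`, and Lagrange interpolation then determines the atoms of an exchangeable law.

The prescribed atoms solve the moment equations on this support (`sum_choose_mul_secondLastAtom`).
So both formulas hold at `p` once all these atoms are nonnegative (`secondLastFormulas_of_nonneg`);
conversely the formulas make them probabilities.

What remains is a sign analysis. Put `x = 1 - p`, `d = n - k`. For `x > 0`, the atom with `k + 1`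
zeros requires `x ≥ 1/(d+1)`, and the one with `k` zeros requires `x ≤ 2/(d+1)`. The atom with `k -
l` zeros is `x^(k-l) R_l(x)`, with `R_l` the `reducedAtom`. `R_2` is positive, which settles `k =
2`. `R_3` is the strictly decreasing cubic of the statement, and a recursion in `l` shows that up to
its zero all other `R_l` are nonnegative (`reducedAtom_nonneg`), so for `k ≥ 4` that zero is the
threshold. -/

/-! ### Reduced atoms and their recursion -/

/-- The value of the atom with `k - l` zeros, divided by `(1 - p) ^ (k - l)`, where `d = n - k`. -/
noncomputable def reducedAtom (d l : ℕ) (x : ℝ) : ℝ :=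
  bonferroni (d + l) l x + (-1) ^ l * (((d + l).choose (l + 1) : ℝ) / ((d + 1).choose 2 : ℝ)) *
    x ^ (l - 1) * (1 - ((d : ℝ) + 1) * x)

/-- The quadratic factor of the increments of `reducedAtom`. -/
noncomputable def incrementFactor (d l : ℝ) (x : ℝ) : ℝ :=
  d * (d + 1) * x ^ 2 + 2 * (1 + (d - 1) * x / (l + 1)) * (1 - (d + 1) * x)

theorem bonferroni_natCast (m l : ℕ) (x : ℝ) :
    bonferroni m l x = ∑ j ∈ Finset.range (l + 1), (-1) ^ j * (m.choose j : ℝ) * x ^ j := by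
  unfold bonferroni
  rfl

theorem bonferroni_one (m : ℕ) (x : ℝ) : bonferroni m 1 x = 1 - m * x := by
  have := bonferroni_natCast m 1 x
  simp only [Nat.cast_one] at this
  rw [this]
  simp [Finset.sum_range_succ]
  ring

theorem bonferroni_succ (m l : ℕ) (x : ℝ) :
    bonferroni m ((l + 1 : ℕ) : ℤ) x =
      bonferroni m l x + (-1) ^ (l + 1) * (m.choose (l + 1) : ℝ) * x ^ (l + 1) := by
  rw [bonferroni_natCast, bonferroni_natCast, Finset.sum_range_succ]

theorem bonferroni_pascal (m l : ℕ) (x : ℝ) :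
    bonferroni (m + 1) ((l + 1 : ℕ) : ℤ) x =
      bonferroni m ((l + 1 : ℕ) : ℤ) x - x * bonferroni m l x := by
  induction l with
  | zero =>
    have h0 : ∀ m, bonferroni m ((0 : ℕ) : ℤ) x = 1 := fun m => by
      rw [bonferroni_natCast]; simp
    rw [h0, zero_add, Nat.cast_one, bonferroni_one, bonferroni_one]
    push_cast
    ring
  | succ l ih =>
    rw [bonferroni_succ (m + 1) (l + 1), ih, bonferroni_succ m (l + 1), bonferroni_succ m l,
      Nat.choose_succ_succ m (l + 1)]
    push_cast
    ring

theorem choose_succ_mul_cast (d j : ℕ) :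
    ((d + (j + 1)).choose (j + 1) : ℝ) * (j + 1) = (d + (j + 1)) * ((d + j).choose j : ℝ) := by
  have := Nat.add_one_mul_choose_eq (d + j) j
  have h : ((d + j + 1 : ℕ) : ℝ) * ((d + j).choose j : ℝ) =
    ((d + j + 1).choose (j + 1) : ℝ) * ((j + 1 : ℕ) : ℝ) := by exact_mod_cast this
  push_cast at h
  rw [← add_assoc]
  linarith

theorem choose_right_succ_cast (d j : ℕ) :
    ((d + j).choose (j + 1) : ℝ) * (j + 1) = d * ((d + j).choose j : ℝ) := by
  have := Nat.choose_succ_right_eq (d + j) j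
  rw [Nat.add_sub_cancel] at this
  have h : ((d + j).choose (j + 1) : ℝ) * ((j + 1 : ℕ) : ℝ) =
    ((d + j).choose j : ℝ) * (d : ℝ) := by exact_mod_cast this
  push_cast at h
  linarith

theorem cast_choose_two_succ (d : ℕ) : ((d + 1).choose 2 : ℝ) = (d + 1) * d / 2 := by
  rw [Nat.cast_choose_two]
  push_cast
  ring

/-- By `bonferroni_pascal`, raising both indices of the Bonferroni sum multiplies it by `1 - x` up
to one top term. The leftover monomials share a single binomial coefficient and collect into
`incrementFactor`, with alternating sign. -/
theorem reducedAtom_succ (d j : ℕ) (hd : 0 < d) (x : ℝ) :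
    reducedAtom d (j + 3) x = (1 - x) * reducedAtom d (j + 2) x + (-1) ^ (j + 1) *
      (((d + (j + 2)).choose (j + 1) : ℝ) * x ^ (j + 1) / ((j + 3) * (j + 2)) *
        incrementFactor d (j + 3) x) := by
  unfold reducedAtom incrementFactor
  have hp := bonferroni_pascal (d + (j + 2)) (j + 2) x
  have hs := bonferroni_succ (d + (j + 2)) (j + 2) x
  rw [show d + (j + 3) = d + (j + 2) + 1 from rfl, show j + 3 = j + 2 + 1 from rfl, hp, hs]
  have hd' : (0 : ℝ) < d := by exact_mod_cast hd
  have hj : (0 : ℝ) ≤ j := by positivity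
  obtain ⟨c, hc⟩ : ∃ c : ℝ, c = ((d + (j + 2)).choose (j + 1) : ℝ) := ⟨_, rfl⟩
  have e1 : ((d + (j + 2)).choose (j + 1 + 1) : ℝ) * (j + 2) = (d + 1) * c := by
    have := choose_right_succ_cast (d + 1) (j + 1)
    rw [show d + 1 + (j + 1) = d + (j + 2) by ring] at this
    push_cast at this
    rw [hc]; linarith
  have e2 : ((d + (j + 2)).choose (j + 2 + 1) : ℝ) * (j + 3) =
      d * ((d + (j + 2)).choose (j + 1 + 1) : ℝ) := by
    have := choose_right_succ_cast d (j + 2)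
    push_cast at this
    linarith
  have e3 : ((d + (j + 2) + 1).choose (j + 2 + 1 + 1) : ℝ) * (j + 4) =
      (d + j + 3) * ((d + (j + 2)).choose (j + 2 + 1) : ℝ) := by
    have := Nat.add_one_mul_choose_eq (d + (j + 2)) (j + 2 + 1)
    have h : ((d + (j + 2) + 1 : ℕ) : ℝ) * ((d + (j + 2)).choose (j + 2 + 1) : ℝ) =
      ((d + (j + 2) + 1).choose (j + 2 + 1 + 1) : ℝ) * ((j + 2 + 1 + 1 : ℕ) : ℝ) := by
      exact_mod_cast this
    push_cast at h
    linarith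
  have f1 := eq_div_of_mul_eq (by positivity) e1
  have f2 := eq_div_of_mul_eq (by positivity) e2
  have f3 := eq_div_of_mul_eq (by positivity) e3
  rw [f1] at f2
  rw [f2] at f3
  rw [f3, f2, cast_choose_two_succ, ← hc]
  simp only [show j + 2 + 1 - 1 = j + 2 from rfl,
    show j + 2 - 1 = j + 1 from rfl]
  push_cast
  field_simp
  ring

theorem reducedAtom_two (d : ℕ) (hd : 0 < d) (x : ℝ) :
    reducedAtom d 2 x = 1 - 2 * (d + 2) / 3 * x + (d + 2) * (d + 1) / 6 * x ^ 2 := by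
  unfold reducedAtom
  have hd' : (0 : ℝ) < d := by exact_mod_cast hd
  have f1 : ((d + 2).choose 2 : ℝ) = (d + 2) * (d + 1) / 2 := by
    rw [Nat.cast_choose_two]; push_cast; ring
  have f2 : ((d + 2).choose 3 : ℝ) = (d + 2) * (d + 1) * d / 6 := by
    have := choose_right_succ_cast d 2
    rw [f1] at this
    push_cast at this
    linarith
  rw [bonferroni_natCast, f2, cast_choose_two_succ]
  simp only [Finset.sum_range_succ, Finset.sum_range_zero, f1, Nat.choose_zero_right,
    Nat.choose_one_right]
  push_cast
  field_simp
  ring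

theorem reducedAtom_three (d : ℕ) (hd : 0 < d) (x : ℝ) :
    reducedAtom d 3 x = 1 - (d + 3) * x + 5 / 12 * ((d + 3) * (d + 2)) * x ^ 2 -
      1 / 12 * ((d + 3) * (d + 2) * (d + 1)) * x ^ 3 := by
  have := reducedAtom_succ d 0 hd x
  rw [zero_add, zero_add] at this
  rw [this, reducedAtom_two d hd]
  unfold incrementFactor
  simp
  field_simp
  ring

theorem intervalCubic_eq (n k : ℕ) (x : ℝ) :
    intervalCubic n k x = 1 - ((n - k : ℕ) + 3) * x +
      5 / 12 * (((n - k : ℕ) + 3) * ((n - k : ℕ) + 2)) * x ^ 2 -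
      1 / 12 * (((n - k : ℕ) + 3) * ((n - k : ℕ) + 2) * ((n - k : ℕ) + 1)) * x ^ 3 := by
  unfold intervalCubic
  generalize n - k = d
  have f1 : ((d + 3).choose 2 : ℝ) = (d + 3) * (d + 2) / 2 := by
    rw [Nat.cast_choose_two]; push_cast; ring
  have f2 : ((d + 3).choose 3 : ℝ) = (d + 3) * (d + 2) * (d + 1) / 6 := by
    have := choose_right_succ_cast (d + 1) 2
    rw [show d + 1 + 2 = d + 3 by ring, f1] at this
    push_cast at this
    linarith
  rw [f1, f2, Nat.choose_one_right]
  push_cast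
  ring

/-! ### Signs of the increments and of the reduced atoms -/

theorem incrementFactor_nonneg (d l x : ℝ) (hd : 2 ≤ d) (hl : 4 ≤ l)
    (h1 : 1 ≤ (d + 1) * x) : 0 ≤ incrementFactor d l x := by
  have hx : 0 < x := by
    by_contra h
    nlinarith
  have hw : 1 / (l + 1) ≤ 1 / 5 := one_div_le_one_div_of_le (by norm_num) (by linarith)
  have hq : incrementFactor d l x = d * (d + 1) * x ^ 2 + 2 * (1 - (d + 1) * x) -
      2 * ((d - 1) * x * ((d + 1) * x - 1)) * (1 / (l + 1)) := by
    unfold incrementFactor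
    field_simp
    ring
  have hb : 0 ≤ (d - 1) * x * ((d + 1) * x - 1) :=
    mul_nonneg (mul_nonneg (by linarith) hx.le) (by linarith)
  have hm := mul_le_mul_of_nonneg_left hw hb
  -- In this range the factor decreases in `1 / (l + 1)`, so `1 / 5` is the worst case. It is scaled
  -- so that the square in `(d + 1) * x` completes.
  have key : 0 ≤ (3 * d + 2) * (d + 1) * (5 * (d * (d + 1) * x ^ 2) + 10 * (1 - (d + 1) * x) -
      2 * ((d - 1) * x * ((d + 1) * x - 1))) := by
    have : (3 * d + 2) * (d + 1) * (5 * (d * (d + 1) * x ^ 2) + 10 * (1 - (d + 1) * x) -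
      2 * ((d - 1) * x * ((d + 1) * x - 1))) =
      ((3 * d + 2) * ((d + 1) * x) - (4 * d + 6)) ^ 2 + (14 * d ^ 2 + 2 * d - 16) := by ring
    rw [this]
    nlinarith [sq_nonneg ((3 * d + 2) * ((d + 1) * x) - (4 * d + 6))]
  have := nonneg_of_mul_nonneg_right key (by positivity)
  rw [hq]
  linarith

/-- Up to a common factor this compares the negative increment at an odd index `l` with `1 - x`
times the positive one before it. With `a` and `b` as below, `incrementFactor d l x = a - 2 * b / (l
+ 1)`. -/
theorem increment_le (d : ℕ) (l x : ℝ) (hd : 2 ≤ d) (hl : 5 ≤ l)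
    (h1 : 1 ≤ ((d : ℝ) + 1) * x) (h2 : (2 * (d : ℝ) + 5) * x ≤ 4) :
    (d + l - 1) * x * incrementFactor d l x ≤ l * (1 - x) * incrementFactor d (l - 1) x := by
  have hd' : (2 : ℝ) ≤ d := by exact_mod_cast hd
  have hcase : (d : ℝ) = 2 ∨ (3 : ℝ) ≤ d := by
    rcases hd.eq_or_lt with h | h
    · left; exact_mod_cast h.symm
    · right; exact_mod_cast h
  generalize (d : ℝ) = D at *
  have hx : 0 < x := by
    by_contra h
    nlinarith
  have hx2 : 9 * x ≤ 4 := by nlinarith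
  obtain ⟨a, ha⟩ : ∃ a, a = D * (D + 1) * x ^ 2 + 2 * (1 - (D + 1) * x) := ⟨_, rfl⟩
  obtain ⟨b, hb⟩ : ∃ b, b = (D - 1) * x * ((D + 1) * x - 1) := ⟨_, rfl⟩
  have hb0 : 0 ≤ b := by
    rw [hb]
    exact mul_nonneg (mul_nonneg (by linarith) hx.le) (by linarith)
  have ha0 : 0 ≤ a := by
    have : 0 ≤ D * (D + 1) * a := by
      have : D * (D + 1) * a = (D * ((D + 1) * x) - (D + 1)) ^ 2 + (D + 1) * (D - 1) := by
        rw [ha]; ring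
      rw [this]
      nlinarith [sq_nonneg (D * ((D + 1) * x) - (D + 1))]
    exact nonneg_of_mul_nonneg_right this (by positivity)
  have q1 : l * incrementFactor D (l - 1) x = l * a - 2 * b := by
    unfold incrementFactor
    rw [ha, hb, sub_add_cancel]
    field_simp
    ring
  have q2 : (l + 1) * incrementFactor D l x = (l + 1) * a - 2 * b := by
    unfold incrementFactor
    rw [ha, hb]
    field_simp
    ring
  have hmain : (2 * D - 3) * (2 * b) ≤ (6 * D - 11) * a := by
    have hy : 0 ≤ (D + 1) * ((6 * D - 11) * a - (2 * D - 3) * (2 * b)) := by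
      have e : (D + 1) * ((6 * D - 11) * a - (2 * D - 3) * (2 * b)) =
          (2 * D ^ 2 - D - 6) * ((D + 1) * x) ^ 2 - (8 * D ^ 2 - 28) * ((D + 1) * x) +
            (12 * D ^ 2 - 10 * D - 22) := by
        rw [ha, hb]; ring
      rw [e]
      -- The leading coefficient `(2D + 3)(D - 2)` vanishes at `D = 2`, where the expression is
      -- linear; otherwise the square is completed.
      rcases hcase with rfl | h3
      · norm_num
        linarith
      · have e2 : (2 * D ^ 2 - D - 6) * ((2 * D ^ 2 - D - 6) * ((D + 1) * x) ^ 2 -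
            (8 * D ^ 2 - 28) * ((D + 1) * x) + (12 * D ^ 2 - 10 * D - 22)) =
            ((2 * D ^ 2 - D - 6) * ((D + 1) * x) - (4 * D ^ 2 - 14)) ^ 2 +
              (8 * D ^ 4 - 32 * D ^ 3 + 6 * D ^ 2 + 82 * D - 64) := by ring
        have e3 : 0 ≤ 8 * D ^ 4 - 32 * D ^ 3 + 6 * D ^ 2 + 82 * D - 64 := by
          obtain ⟨t, rfl⟩ : ∃ t, D = t + 3 := ⟨D - 3, by ring⟩
          have ht : 0 ≤ t := by linarith
          have : 8 * (t + 3) ^ 4 - 32 * (t + 3) ^ 3 + 6 * (t + 3) ^ 2 + 82 * (t + 3) - 64 =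
            8 * t ^ 4 + 64 * t ^ 3 + 150 * t ^ 2 + 118 * t + 20 := by ring
          rw [this]
          positivity
        have e4 : 0 < 2 * D ^ 2 - D - 6 := by nlinarith
        refine nonneg_of_mul_nonneg_right ?_ e4
        rw [e2]
        positivity
    have := nonneg_of_mul_nonneg_right hy (by positivity)
    linarith
  -- This is `h2` multiplied by `D - 1`, since `(2D - 3)(D + 1) + 2(2D - 1) = (2D + 5)(D - 1)`. The
  -- coefficient `6D - 11` in `hmain` gives `(2D - 1) a ≤ (2D - 3)(4a - 2b)`, which matches it.
  have hs : (2 * D - 3) * ((D + 1) * x - 1) ≤ (2 * D - 1) * (1 - 2 * x) := by nlinarith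
  have h5 : ((D + 1) * x - 1) * a ≤ (1 - 2 * x) * (4 * a - 2 * b) := by
    have hpos : 0 < 2 * D - 3 := by linarith
    have i1 := mul_le_mul_of_nonneg_right hs ha0
    have i2 := mul_le_mul_of_nonneg_left hmain (show 0 ≤ 1 - 2 * x by linarith)
    refine le_of_mul_le_mul_left ?_ hpos
    nlinarith
  have hl1 : 0 < l + 1 := by linarith
  -- Isolates the excess over `l = 5`, so that `h5` handles the rest of the bracket.
  have hfin : (l + 1) * (l * (1 - x) * incrementFactor D (l - 1) x -
      (D + l - 1) * x * incrementFactor D l x) =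
      (l + 1) * (((l - 5) * (1 - 2 * x)) * a + ((1 - 2 * x) * (4 * a - 2 * b) -
        ((D + 1) * x - 1) * a)) + 2 * (D - 2) * (x * b) := by
    have : (l + 1) * (l * (1 - x) * incrementFactor D (l - 1) x -
      (D + l - 1) * x * incrementFactor D l x) =
      (l + 1) * (1 - x) * (l * incrementFactor D (l - 1) x) -
      (D + l - 1) * x * ((l + 1) * incrementFactor D l x) := by ring
    rw [this, q1, q2]
    ring
  have hnn : 0 ≤ (l + 1) * (l * (1 - x) * incrementFactor D (l - 1) x -
      (D + l - 1) * x * incrementFactor D l x) := by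
    rw [hfin]
    have j1 : 0 ≤ ((l - 5) * (1 - 2 * x)) * a :=
      mul_nonneg (mul_nonneg (by linarith) (by linarith)) ha0
    have j2 : 0 ≤ 2 * (D - 2) * (x * b) :=
      mul_nonneg (by linarith) (mul_nonneg hx.le hb0)
    have j3 : 0 ≤ (l + 1) * (((l - 5) * (1 - 2 * x)) * a + ((1 - 2 * x) * (4 * a - 2 * b) -
        ((D + 1) * x - 1) * a)) := mul_nonneg hl1.le (by linarith)
    linarith
  have := nonneg_of_mul_nonneg_right hnn hl1
  linarith

theorem reducedAtom_two_pos (d : ℕ) (hd : 2 ≤ d) (x : ℝ) : 0 < reducedAtom d 2 x := by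
  have hd' : (2 : ℝ) ≤ d := by exact_mod_cast hd
  rw [reducedAtom_two d (by omega)]
  have : 0 < (d + 2) * (d + 1) * (1 - 2 * (d + 2) / 3 * x + (d + 2) * (d + 1) / 6 * x ^ 2) := by
    have : (d + 2) * (d + 1) * (1 - 2 * (d + 2) / 3 * x + (d + 2) * (d + 1) / 6 * x ^ 2) =
      1 / 6 * ((d + 2) * ((d + 1) * x - 2)) ^ 2 + (d + 2) * (d - 1) / 3 := by ring
    rw [this]
    have : 0 < (d + 2) * ((d : ℝ) - 1) / 3 :=
      div_pos (mul_pos (by linarith) (by linarith)) (by norm_num)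
    positivity
  exact pos_of_mul_pos_right this (by positivity)

/-- The difference quotient is a quadratic in `x + y` and `x - y` that becomes a sum of squares plus
a positive constant. No range for `x` is needed. -/
theorem reducedAtom_three_strictAnti (d : ℕ) (hd : 2 ≤ d) : StrictAnti (reducedAtom d 3) := by
  intro x y hxy
  have hd' : (2 : ℝ) ≤ d := by exact_mod_cast hd
  rw [reducedAtom_three d (by omega), reducedAtom_three d (by omega)]
  generalize (d : ℝ) = D at *
  have hf : (1 - (D + 3) * x + 5 / 12 * ((D + 3) * (D + 2)) * x ^ 2 -
      1 / 12 * ((D + 3) * (D + 2) * (D + 1)) * x ^ 3) -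
      (1 - (D + 3) * y + 5 / 12 * ((D + 3) * (D + 2)) * y ^ 2 -
      1 / 12 * ((D + 3) * (D + 2) * (D + 1)) * y ^ 3) = (D + 3) * (y - x) / 12 *
      (12 - 5 * (D + 2) * (x + y) + (D + 2) * (D + 1) * (x ^ 2 + x * y + y ^ 2)) := by ring
  have hp : 0 < 12 - 5 * (D + 2) * (x + y) + (D + 2) * (D + 1) * (x ^ 2 + x * y + y ^ 2) := by
    have e : (D + 1) * (12 - 5 * (D + 2) * (x + y) +
        (D + 2) * (D + 1) * (x ^ 2 + x * y + y ^ 2)) =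
        (D + 2) / 12 * (3 * (D + 1) * (x + y) - 10) ^ 2 +
        (D + 2) / 4 * ((D + 1) * (x - y)) ^ 2 + (11 * D - 14) / 3 := by ring
    have : 0 < (D + 1) * (12 - 5 * (D + 2) * (x + y) +
        (D + 2) * (D + 1) * (x ^ 2 + x * y + y ^ 2)) := by
      rw [e]
      have : 0 < (11 * D - 14) / 3 := by linarith
      positivity
    exact pos_of_mul_pos_right this (by positivity)
  have : 0 < (D + 3) * (y - x) / 12 := by
    have : 0 < y - x := by linarith
    positivity
  have := mul_pos this hp
  linarith

/-- The bound `4 / (2d + 5)` is a point where the cubic is already negative, lies below `2 / (d +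
1)`, and is small enough for `increment_le`. -/
theorem exists_reducedAtom_three_eq_zero (d : ℕ) (hd : 2 ≤ d) :
    ∃ x : ℝ, 1 < (d + 1) * x ∧ (2 * d + 5) * x ≤ 4 ∧ reducedAtom d 3 x = 0 := by
  have hd' : (2 : ℝ) ≤ d := by exact_mod_cast hd
  have hcont : Continuous (reducedAtom d 3) := by
    have : reducedAtom d 3 = _ := funext (reducedAtom_three d (by omega))
    rw [this]
    fun_prop
  have hlo : 0 < reducedAtom d 3 (1 / (d + 1)) := by
    rw [reducedAtom_three d (by omega)]
    have : 1 - ((d : ℝ) + 3) * (1 / (d + 1)) + 5 / 12 * ((d + 3) * (d + 2)) * (1 / (d + 1)) ^ 2 -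
      1 / 12 * ((d + 3) * (d + 2) * (d + 1)) * (1 / (d + 1)) ^ 3 =
      d * (d - 1) / (3 * (d + 1) ^ 2) := by
      field_simp
      ring
    rw [this]
    exact div_pos (mul_pos (by linarith) (by linarith)) (by positivity)
  have hhi : reducedAtom d 3 (4 / (2 * d + 5)) ≤ 0 := by
    rw [reducedAtom_three d (by omega)]
    have : 1 - ((d : ℝ) + 3) * (4 / (2 * d + 5)) +
      5 / 12 * ((d + 3) * (d + 2)) * (4 / (2 * d + 5)) ^ 2 -
      1 / 12 * ((d + 3) * (d + 2) * (d + 1)) * (4 / (2 * d + 5)) ^ 3 =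
      - ((2 * d + 7) / (2 * d + 5) ^ 3) := by
      field_simp
      ring
    rw [this]
    exact neg_nonpos.mpr (by positivity)
  have hle : (1 : ℝ) / (d + 1) ≤ 4 / (2 * d + 5) := by
    rw [div_le_div_iff₀ (by positivity) (by positivity)]
    linarith
  obtain ⟨x, hx, h0⟩ := intermediate_value_Icc' hle hcont.continuousOn ⟨hhi, hlo.le⟩
  refine ⟨x, ?_, ?_, h0⟩
  · have hne : 1 / ((d : ℝ) + 1) ≠ x := by
      rintro rfl
      exact hlo.ne' h0
    have := lt_of_le_of_ne hx.1 hne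
    rw [div_lt_iff₀ (by positivity)] at this
    linarith
  · have := hx.2
    rw [le_div_iff₀ (by positivity)] at this
    linarith

/-- Odd indices follow by induction in steps of two: the recursion adds a positive and then a
negative increment, and `increment_le` says the first outweighs the second. An even index above 2 is
one positive increment past an odd one. -/
theorem reducedAtom_nonneg (d : ℕ) (hd : 2 ≤ d) (x : ℝ) (h1 : 1 ≤ ((d : ℝ) + 1) * x)
    (h2 : (2 * (d : ℝ) + 5) * x ≤ 4) (h3 : 0 ≤ reducedAtom d 3 x) (l : ℕ) (hl : 2 ≤ l) :
    0 ≤ reducedAtom d l x := by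
  have hd' : (2 : ℝ) ≤ d := by exact_mod_cast hd
  have hx : 0 < x := by
    by_contra h
    nlinarith
  have hx1 : 0 ≤ 1 - x := by nlinarith
  have hodd : ∀ t : ℕ, 0 ≤ reducedAtom d (2 * t + 3) x := by
    intro t
    induction t with
    | zero => exact h3
    | succ t ih =>
      have r1 := reducedAtom_succ d (2 * t + 2) (by omega) x
      have r2 := reducedAtom_succ d (2 * t + 1) (by omega) x
      have s1 : (-1 : ℝ) ^ (2 * t + 2 + 1) = -1 := Odd.neg_one_pow ⟨t + 1, by ring⟩
      have s2 : (-1 : ℝ) ^ (2 * t + 1 + 1) = 1 := Even.neg_one_pow ⟨t + 1, by ring⟩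
      rw [s2, one_mul] at r2
      rw [s1, show 2 * t + 2 + 2 = 2 * t + 1 + 3 by ring, r2] at r1
      rw [show 2 * (t + 1) + 3 = 2 * t + 2 + 3 by ring, r1]
      have hq := increment_le d (2 * t + 5) x hd (by linarith [Nat.cast_nonneg (α := ℝ) t]) h1 h2
      obtain ⟨c, hc⟩ : ∃ c : ℝ, c = ((d + (2 * t + 1 + 2)).choose (2 * t + 1 + 1) : ℝ) :=
        ⟨_, rfl⟩
      have hc0 : 0 ≤ c := by rw [hc]; positivity
      have e : ((d + (2 * t + 1 + 3)).choose (2 * t + 2 + 1) : ℝ) * (2 * t + 3) =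
          (d + 2 * t + 4) * c := by
        have := choose_succ_mul_cast (d + 1) (2 * t + 2)
        rw [show d + 1 + (2 * t + 2 + 1) = d + (2 * t + 1 + 3) by ring,
          show d + 1 + (2 * t + 2) = d + (2 * t + 1 + 2) by ring] at this
        rw [hc]
        push_cast at this ⊢
        linarith
      have e' := eq_div_of_mul_eq (by positivity) e
      rw [← hc, e']
      push_cast
      rw [show (2 * (t : ℝ) + 5 - 1) = 2 * t + 1 + 3 by ring,
        show (2 * (t : ℝ) + 5) = 2 * t + 2 + 3 by ring] at hq
      generalize incrementFactor d (2 * t + 1 + 3) x = q1 at *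
      generalize incrementFactor d (2 * t + 2 + 3) x = q2 at *
      -- The factor that turns `increment_le` into the comparison of the two actual increments.
      have hfac : 0 ≤ c * x ^ (2 * t + 2) /
          ((2 * t + 3) * (2 * t + 4) * (2 * t + 5)) := by positivity
      have hprod := mul_le_mul_of_nonneg_left hq hfac
      have k1 : c * x ^ (2 * t + 2) / ((2 * t + 3) * (2 * t + 4) * (2 * t + 5)) *
          ((d + (2 * t + 2 + 3) - 1) * x * q2) = (d + 2 * t + 4) * c / (2 * t + 3) *
          x ^ (2 * t + 2 + 1) / ((2 * t + 2 + 3) * (2 * t + 2 + 2)) * q2 := by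
        field_simp
        ring
      have k2 : c * x ^ (2 * t + 2) / ((2 * t + 3) * (2 * t + 4) * (2 * t + 5)) *
          ((2 * t + 2 + 3) * (1 - x) * q1) = (1 - x) * (c *
          x ^ (2 * t + 1 + 1) / ((2 * t + 1 + 3) * (2 * t + 1 + 2)) * q1) := by
        field_simp
        ring
      rw [k1, k2] at hprod
      have := mul_nonneg hx1 (mul_nonneg hx1 ih)
      rw [show 2 * t + 1 + 2 = 2 * t + 3 by ring]
      linarith
  rcases Nat.even_or_odd' l with ⟨t, rfl | rfl⟩
  · rcases Nat.lt_or_ge t 2 with ht | ht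
    · obtain rfl : t = 1 := by omega
      exact (reducedAtom_two_pos d hd x).le
    · obtain ⟨s, rfl⟩ := Nat.exists_eq_add_of_le ht
      have r := reducedAtom_succ d (2 * s + 1) (by omega) x
      have s2 : (-1 : ℝ) ^ (2 * s + 1 + 1) = 1 := Even.neg_one_pow ⟨s + 1, by ring⟩
      rw [s2, one_mul] at r
      rw [show 2 * (2 + s) = 2 * s + 1 + 3 by ring, r]
      have hq := incrementFactor_nonneg d ((2 * s + 1 : ℕ) + 3) x hd'
        (by push_cast; linarith [Nat.cast_nonneg (α := ℝ) s]) h1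
      have := mul_nonneg hx1 (hodd s)
      rw [show 2 * s + 1 + 2 = 2 * s + 3 by ring]
      positivity
  · obtain ⟨s, rfl⟩ := Nat.exists_eq_add_of_le (show 1 ≤ t by omega)
    rw [show 2 * (1 + s) + 1 = 2 * s + 3 by ring]
    exact hodd s

/-! ### Moment equations for the prescribed atoms -/

/-- Since `C(N,m) C(N-m,K+1-m) = C(N,K+1) C(K+1,m)`, this is an alternating row sum. It shows that
the correction term in the atoms does not affect the moments. -/
theorem sum_choose_mul_choose_alternating (N K : ℕ) :
    ∑ m ∈ Finset.range (K + 2), (N.choose m : ℝ) * ((N - m).choose (K + 1 - m) : ℝ) * (-1) ^ m =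
      0 := by
  have h : ∀ m ∈ Finset.range (K + 2),
      (N.choose m : ℝ) * ((N - m).choose (K + 1 - m) : ℝ) * (-1) ^ m =
        (N.choose (K + 1) : ℝ) * (((-1 : ℤ) ^ m * ((K + 1).choose m : ℤ) : ℤ) : ℝ) := by
    intro m hm
    have h1 := Nat.choose_mul (n := N) (k := K + 1) (s := m)
      (Nat.lt_succ_iff.mp (Finset.mem_range.mp hm))
    have h2 : (N.choose (K + 1) : ℝ) * ((K + 1).choose m : ℝ) =
      (N.choose m : ℝ) * ((N - m).choose (K + 1 - m) : ℝ) := by exact_mod_cast h1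
    push_cast
    rw [← h2]
    ring
  rw [Finset.sum_congr rfl h, ← Finset.mul_sum, ← Int.cast_sum,
    Int.alternating_sum_range_choose]
  simp

/-- Raising the truncation order by one adds a multiple of the preceding alternating sum. The
Bonferroni part of the atoms thus has the required moments by itself. -/
theorem sum_choose_mul_bonferroni (N K : ℕ) (x : ℝ) :
    ∑ m ∈ Finset.range (K + 1), (N.choose m : ℝ) * x ^ m *
      bonferroni (N - m) ((K - m : ℕ) : ℤ) x = 1 := by
  induction K with
  | zero => simp [bonferroni]
  | succ K ih =>
    have h0 := sum_choose_mul_choose_alternating N K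
    have hsplit : ∀ m ∈ Finset.range (K + 1),
        (N.choose m : ℝ) * x ^ m * bonferroni (N - m) ((K + 1 - m : ℕ) : ℤ) x =
        (N.choose m : ℝ) * x ^ m * bonferroni (N - m) ((K - m : ℕ) : ℤ) x +
        (-1) ^ (K + 1) * x ^ (K + 1) *
          ((N.choose m : ℝ) * ((N - m).choose (K + 1 - m) : ℝ) * (-1) ^ m) := by
      intro m hm
      obtain ⟨r, rfl⟩ := Nat.exists_eq_add_of_le (Nat.lt_succ_iff.mp (Finset.mem_range.mp hm))
      have e1 : m + r + 1 - m = r + 1 := by omega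
      have e2 : m + r - m = r := by omega
      rw [e1, e2, bonferroni_succ]
      have e3 : (-1 : ℝ) ^ (m + r + 1) * (-1) ^ m = (-1) ^ (r + 1) := by
        rw [show m + r + 1 = m + (r + 1) by ring, pow_add, mul_right_comm, ← mul_pow]
        simp
      have e4 : x ^ (m + r + 1) = x ^ m * x ^ (r + 1) := by ring
      rw [e4, ← e3]
      ring
    rw [Finset.sum_range_succ, Finset.sum_congr rfl hsplit, Finset.sum_add_distrib, ih,
      ← Finset.mul_sum]
    rw [Finset.sum_range_succ] at h0
    have hB : bonferroni (N - (K + 1)) ((K + 1 - (K + 1) : ℕ) : ℤ) x = 1 := by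
      simp [bonferroni]
    rw [hB, eq_neg_of_add_eq_zero_left h0]
    have e3 : (-1 : ℝ) ^ (K + 1) * (-1) ^ (K + 1) = 1 := by
      rw [← mul_pow]; simp
    simp only [Nat.sub_self, Nat.choose_zero_right, Nat.cast_one, mul_one]
    linear_combination (-(N.choose (K + 1) : ℝ) * x ^ (K + 1)) * e3

theorem mem_secondLastSupport_iff {n k i : ℕ} (hk : 2 ≤ k) (hkn : k + 2 ≤ n) (hi : i ≤ n) :
    n - i ∈ secondLastSupport n k ↔ i ≤ k + 1 ∧ i ≠ k - 1 := by
  simp only [secondLastSupport, Finset.mem_union, Finset.mem_insert, Finset.mem_singleton,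
    Finset.mem_Icc]
  omega

/-- The coefficient of the correction is chosen so that the closed form vanishes at `i = k - 1`, the
gap in the support; hence no case distinction remains for `i ≤ k + 1`. -/
theorem secondLastAtom_eq {n k : ℕ} (hkeven : Even k) (hk : 2 ≤ k) (hkn : k + 2 ≤ n) (p : ℝ)
    {i : ℕ} (hi : i ≤ k + 1) :
    secondLastAtom n k p i = (1 - p) ^ i * bonferroni (n - i) ((k : ℤ) - i) (1 - p) +
      (1 - p) ^ (k - 1) * bonferroni (n - k + 1) 1 (1 - p) / ((n - k + 1).choose 2 : ℝ) *
        ((-1) ^ i * ((n - i).choose (k + 1 - i) : ℝ)) := by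
  have hs : (-1 : ℝ) ^ (k + i + 1) = -(-1) ^ i := by
    rw [pow_succ, pow_add, hkeven.neg_one_pow]; ring
  unfold secondLastAtom
  split_ifs with h
  · rw [hs]
    ring
  · rw [mem_secondLastSupport_iff hk hkn (by omega)] at h
    obtain rfl : i = k - 1 := by omega
    have hodd : (-1 : ℝ) ^ (k - 1) = -1 := (Nat.Even.sub_odd (by omega) hkeven odd_one).neg_one_pow
    rw [hodd, show n - (k - 1) = n - k + 1 by omega, show k + 1 - (k - 1) = 2 by omega,
      show (k : ℤ) - ((k - 1 : ℕ) : ℤ) = 1 by omega]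
    have : ((n - k + 1).choose 2 : ℝ) ≠ 0 := by
      have := Nat.choose_pos (show 2 ≤ n - k + 1 by omega)
      positivity
    field_simp
    ring

theorem secondLastAtom_of_gt {n k : ℕ} (hk : 2 ≤ k) (hkn : k + 2 ≤ n) (p : ℝ) {i : ℕ}
    (hi : k + 1 < i) (hin : i ≤ n) : secondLastAtom n k p i = 0 := by
  unfold secondLastAtom
  rw [if_neg]
  rw [mem_secondLastSupport_iff hk hkn hin]
  omega

theorem sum_choose_mul_secondLastAtom {n k : ℕ} (hkeven : Even k) (hk : 2 ≤ k)
    (hkn : k + 2 ≤ n) (p : ℝ) {t : ℕ} (ht : t ≤ k) :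
    ∑ m ∈ Finset.range (n - t + 1), ((n - t).choose m : ℝ) * secondLastAtom n k p (t + m) =
      (1 - p) ^ t := by
  obtain ⟨K, rfl⟩ := Nat.exists_eq_add_of_le ht
  have hsub : Finset.range (K + 2) ⊆ Finset.range (n - t + 1) :=
    Finset.range_mono (by omega)
  rw [← Finset.sum_subset hsub]
  · set c := (1 - p) ^ (t + K - 1) * bonferroni (n - (t + K) + 1) 1 (1 - p) /
      ((n - (t + K) + 1).choose 2 : ℝ) with hc
    have h : ∀ m ∈ Finset.range (K + 2),
        ((n - t).choose m : ℝ) * secondLastAtom n (t + K) p (t + m) =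
        (1 - p) ^ t * (((n - t).choose m : ℝ) * (1 - p) ^ m *
          bonferroni (n - t - m) ((K : ℤ) - m) (1 - p)) +
        c * (-1) ^ t * (((n - t).choose m : ℝ) * ((n - t - m).choose (K + 1 - m) : ℝ) *
          (-1) ^ m) := by
      intro m hm
      have hm' := Finset.mem_range.mp hm
      rw [secondLastAtom_eq hkeven hk hkn p (by omega), ← hc,
        show n - (t + m) = n - t - m by omega, show t + K + 1 - (t + m) = K + 1 - m by omega]
      have : ((t + K : ℕ) : ℤ) - ((t + m : ℕ) : ℤ) = (K : ℤ) - m := by push_cast; ring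
      rw [this]
      ring
    rw [Finset.sum_congr rfl h, Finset.sum_add_distrib, ← Finset.mul_sum, ← Finset.mul_sum,
      sum_choose_mul_choose_alternating, Finset.sum_range_succ]
    have h1 : ∀ m ∈ Finset.range (K + 1), ((n - t).choose m : ℝ) * (1 - p) ^ m *
          bonferroni (n - t - m) ((K : ℤ) - m) (1 - p) = ((n - t).choose m : ℝ) * (1 - p) ^ m *
          bonferroni (n - t - m) ((K - m : ℕ) : ℤ) (1 - p) := by
      intro m hm
      rw [Nat.cast_sub (Nat.lt_succ_iff.mp (Finset.mem_range.mp hm))]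
    rw [Finset.sum_congr rfl h1, sum_choose_mul_bonferroni]
    have : bonferroni (n - t - (K + 1)) ((K : ℤ) - (K + 1 : ℕ)) (1 - p) = 0 := by
      simp [bonferroni]
    rw [this]
    ring
  · intro m hm hm'
    rw [Finset.mem_range] at hm hm'
    rw [secondLastAtom_of_gt hk hkn p (by omega) (by omega), mul_zero]

/-! ### Laws of random bits and their zero sets -/

/-- The bit string with zeros exactly at the positions in `T`. -/
def zerosAt {n : ℕ} (T : Finset (Fin n)) : Fin n → Bool := fun i => decide (i ∉ T)

/-- The event that all the bits with index in `T` are equal to `0`. -/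
def zerosOn {n : ℕ} (T : Finset (Fin n)) : Set (Fin n → Bool) := {ω | ∀ i ∈ T, ω i = false}

theorem zerosAt_bijective (n : ℕ) : Function.Bijective (zerosAt (n := n)) := by
  refine ⟨fun S T h => ?_, fun ω => ⟨Finset.univ.filter (fun i => ω i = false), ?_⟩⟩
  · ext i
    have := congrFun h i
    simp only [zerosAt, decide_eq_decide] at this
    tauto
  · funext i
    simp [zerosAt]

theorem zerosAt_mem_zerosOn {n : ℕ} (T U : Finset (Fin n)) :
    zerosAt U ∈ zerosOn T ↔ T ⊆ U := by
  simp [zerosAt, zerosOn, Finset.subset_iff]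

theorem measureReal_eq_sum_zerosAt {n : ℕ} (μ : Measure (Fin n → Bool)) [IsFiniteMeasure μ]
    (A : Set (Fin n → Bool)) [DecidablePred (· ∈ A)] :
    μ.real A = ∑ U : Finset (Fin n), if zerosAt U ∈ A then μ.real {zerosAt U} else 0 := by
  have h1 : μ.real A = ∑ ω ∈ Finset.univ.filter (· ∈ A), μ.real {ω} := by
    rw [sum_measureReal_singleton]
    congr 1
    ext ω
    simp
  rw [h1, Finset.sum_filter]
  exact ((zerosAt_bijective n).sum_comp (fun ω => if ω ∈ A then μ.real {ω} else 0)).symm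

theorem measureReal_zerosOn_eq_sum {n : ℕ} (μ : Measure (Fin n → Bool)) [IsFiniteMeasure μ]
    (T : Finset (Fin n)) :
    μ.real (zerosOn T) = ∑ U : Finset (Fin n), if T ⊆ U then μ.real {zerosAt U} else 0 := by
  classical
  rw [measureReal_eq_sum_zerosAt]
  simp only [zerosAt_mem_zerosOn]

/-- The expectation of `h` applied to the number of zeros. -/
def zeroCountMean {n : ℕ} (P : BitLaw n) (h : ℕ → ℝ) : ℝ :=
  ∑ U : Finset (Fin n), (P : Measure (Fin n → Bool)).real {zerosAt U} * h U.card

theorem probAllOnes_eq {n : ℕ} (P : BitLaw n) :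
    probAllOnes P = (P : Measure (Fin n → Bool)).real {zerosAt ∅} := by
  unfold probAllOnes
  congr 1
  ext ω
  simp [zerosAt, funext_iff]

theorem zeroCountMean_choose {n : ℕ} (P : BitLaw n) (j : ℕ) :
    zeroCountMean P (fun z => (z.choose j : ℝ)) =
      ∑ T ∈ Finset.powersetCard j Finset.univ, (P : Measure (Fin n → Bool)).real (zerosOn T) := by
  unfold zeroCountMean
  simp only [measureReal_zerosOn_eq_sum]
  rw [Finset.sum_comm]
  refine Finset.sum_congr rfl fun U _ => ?_
  rw [← Finset.sum_filter, Finset.sum_const, nsmul_eq_mul, mul_comm]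
  congr 2
  rw [← Finset.card_powersetCard]
  congr 1
  ext T
  simp [Finset.mem_powersetCard, and_comm]

theorem measureReal_false {n : ℕ} (μ : Measure (Fin n → Bool)) [IsProbabilityMeasure μ]
    (i : Fin n) : μ.real {ω | ω i = false} = 1 - μ.real {ω | ω i = true} := by
  rw [← probReal_compl_eq_one_sub (Set.toFinite _).measurableSet]
  congr 1
  ext ω
  simp

theorem measureReal_zerosOn {n k : ℕ} (hkn : k ≤ n) {p : ℝ} {P : BitLaw n}
    (hP : P ∈ kWiseLaws n k p) {T : Finset (Fin n)} (hT : T.card ≤ k) :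
    (P : Measure (Fin n → Bool)).real (zerosOn T) = (1 - p) ^ T.card := by
  -- Independence is assumed only for sets of exactly `k` bits, so `T` is enlarged to one.
  obtain ⟨S, hTS, hS⟩ := Finset.exists_superset_card_eq hT (by simpa using hkn)
  have h := (hP.2 S hS).measure_inter_preimage_eq_mul (T.subtype (· ∈ S))
    (sets := fun _ => {false}) (fun _ _ => (Set.toFinite _).measurableSet)
  have hset : (⋂ i ∈ T.subtype (· ∈ S), (fun ω : Fin n → Bool => ω (i : Fin n)) ⁻¹' {false}) =
      zerosOn T := by
    ext ω
    simp only [Set.mem_iInter, Finset.mem_subtype, Set.mem_preimage, Set.mem_singleton_iff,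
      zerosOn, Set.mem_ofPred_eq, Subtype.forall]
    exact ⟨fun h i hi => h i (hTS hi) hi, fun h i _ hi => h i hi⟩
  rw [hset] at h
  unfold Measure.real
  rw [h, ENNReal.toReal_prod]
  have hterm : ∀ i ∈ T.subtype (· ∈ S), ((P : Measure (Fin n → Bool))
      ((fun ω : Fin n → Bool => ω (i : Fin n)) ⁻¹' {false})).toReal = 1 - p := by
    intro i _
    rw [← hP.1 i, ← measureReal_false]
    rfl
  rw [Finset.prod_congr rfl hterm, Finset.prod_const, Finset.card_subtype,
    Finset.filter_true_of_mem hTS]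

theorem mem_kWiseLaws_of_zerosOn {n k : ℕ} (hk : 1 ≤ k) {p : ℝ} {P : BitLaw n}
    (h : ∀ T : Finset (Fin n), T.card ≤ k →
      (P : Measure (Fin n → Bool)).real (zerosOn T) = (1 - p) ^ T.card) :
    P ∈ kWiseLaws n k p := by
  have hone : ∀ i : Fin n, (P : Measure (Fin n → Bool)).real {ω | ω i = false} = 1 - p := by
    intro i
    have := h {i} (by simpa using hk)
    simpa [zerosOn] using this
  refine ⟨fun i => ?_, fun S hS => ?_⟩
  · have := measureReal_false (P : Measure (Fin n → Bool)) i
    rw [hone i] at this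
    linarith
  · have hind : iIndepSet (fun i : S => {ω : Fin n → Bool | ω (i : Fin n) = false})
        (P : Measure (Fin n → Bool)) := by
      rw [iIndepSet_iff_meas_biInter (fun _ => (Set.toFinite _).measurableSet)]
      intro s
      have hset : (⋂ i ∈ s, {ω : Fin n → Bool | ω (i : Fin n) = false}) =
          zerosOn (s.map (Function.Embedding.subtype _)) := by
        ext ω
        simp [zerosOn]
      rw [← ENNReal.toReal_eq_toReal_iff' (measure_ne_top _ _)
        (ENNReal.prod_ne_top fun _ _ => measure_ne_top _ _), ENNReal.toReal_prod, hset]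
      have hcard : (s.map (Function.Embedding.subtype _)).card ≤ k := by
        rw [Finset.card_map, ← hS]
        simpa using Finset.card_le_univ s
      have h1 := h _ hcard
      unfold Measure.real at h1 hone
      rw [h1, Finset.card_map, Finset.prod_congr rfl (fun (i : S) _ => hone i), Finset.prod_const]
    -- Each bit is recovered from the indicator of its zero event: it is `true` exactly where the
    -- indicator is `0`.
    have hf := (hind.iIndepFun_indicator (β := ℝ) (m := inferInstance)).comp (fun _ r => decide (r = 0))
      (fun _ => by
        refine measurable_to_bool ?_
        have : (fun r : ℝ => decide (r = 0)) ⁻¹' {true} = {0} := by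
          ext r
          simp
        rw [this]
        exact measurableSet_singleton 0)
    convert hf using 2 with i
    funext ω
    simp only [Function.comp, Set.indicator, Set.mem_ofPred_eq]
    cases ω (i : Fin n) <;> simp

theorem zeroCountMean_choose_of_mem {n k : ℕ} (hkn : k ≤ n) {p : ℝ} {P : BitLaw n}
    (hP : P ∈ kWiseLaws n k p) {j : ℕ} (hj : j ≤ k) :
    zeroCountMean P (fun z => (z.choose j : ℝ)) = (n.choose j : ℝ) * (1 - p) ^ j := by
  rw [zeroCountMean_choose]
  have : ∀ T ∈ Finset.powersetCard j (Finset.univ : Finset (Fin n)),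
      (P : Measure (Fin n → Bool)).real (zerosOn T) = (1 - p) ^ j := by
    intro T hT
    have hc := (Finset.mem_powersetCard.mp hT).2
    rw [measureReal_zerosOn hkn hP (hc.le.trans hj), hc]
  rw [Finset.sum_congr rfl this, Finset.sum_const, Finset.card_powersetCard, nsmul_eq_mul,
    Finset.card_univ, Fintype.card_fin]

theorem zeroCountMean_add {n : ℕ} (P : BitLaw n) (f g : ℕ → ℝ) :
    zeroCountMean P (f + g) = zeroCountMean P f + zeroCountMean P g := by
  simp [zeroCountMean, mul_add, Finset.sum_add_distrib]

theorem zeroCountMean_smul {n : ℕ} (P : BitLaw n) (c : ℝ) (f : ℕ → ℝ) :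
    zeroCountMean P (c • f) = c * zeroCountMean P f := by
  simp only [zeroCountMean, Finset.mul_sum, Pi.smul_apply, smul_eq_mul]
  exact Finset.sum_congr rfl fun _ _ => by ring

/-! ### Polynomials in the number of zeros and the dual certificate -/

/-- The span of the functions `z ↦ z.choose j`, `j ≤ k`. -/
def binomialSpan (k : ℕ) : Submodule ℝ (ℕ → ℝ) :=
  Submodule.span ℝ ((fun j z => ((z.choose j : ℕ) : ℝ)) '' Set.Iic k)

theorem choose_mem_binomialSpan {j k : ℕ} (h : j ≤ k) :
    (fun z : ℕ => (z.choose j : ℝ)) ∈ binomialSpan k :=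
  Submodule.subset_span ⟨j, h, rfl⟩

theorem sub_mul_mem_binomialSpan {k : ℕ} {f : ℕ → ℝ} (hf : f ∈ binomialSpan k) (a : ℝ) :
    (fun z : ℕ => ((z : ℝ) - a) * f z) ∈ binomialSpan (k + 1) := by
  induction hf using Submodule.span_induction with
  | mem f hf =>
    obtain ⟨j, hj, rfl⟩ := hf
    have hj' : j ≤ k := hj
    have : (fun z : ℕ => ((z : ℝ) - a) * (z.choose j : ℝ)) =
        ((j : ℝ) + 1) • (fun z : ℕ => (z.choose (j + 1) : ℝ)) +
          ((j : ℝ) - a) • (fun z : ℕ => (z.choose j : ℝ)) := by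
      funext z
      simp only [Pi.add_apply, Pi.smul_apply, smul_eq_mul]
      rcases Nat.lt_or_ge z j with h | h
      · rw [Nat.choose_eq_zero_of_lt h, Nat.choose_eq_zero_of_lt (by omega)]
        simp
      · obtain ⟨d, rfl⟩ := Nat.exists_eq_add_of_le' h
        have := choose_right_succ_cast d j
        push_cast
        linarith
    rw [this]
    exact Submodule.add_mem _ (Submodule.smul_mem _ _ (choose_mem_binomialSpan (by omega)))
      (Submodule.smul_mem _ _ (choose_mem_binomialSpan (by omega)))
  | zero =>
    convert (binomialSpan (k + 1)).zero_mem using 1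
    funext z
    simp
  | add f g _ _ hf hg =>
    convert Submodule.add_mem _ hf hg using 1
    funext z
    simp [mul_add]
  | smul c f _ hf =>
    convert Submodule.smul_mem _ c hf using 1
    funext z
    simp only [Pi.smul_apply, smul_eq_mul]
    ring

theorem prod_sub_mem_binomialSpan (s : Finset ℕ) :
    (fun z : ℕ => ∏ a ∈ s, ((z : ℝ) - a)) ∈ binomialSpan s.card := by
  induction s using Finset.induction_on with
  | empty =>
    simpa using choose_mem_binomialSpan (j := 0) le_rfl
  | insert a s ha ih =>
    rw [Finset.card_insert_of_notMem ha]
    simpa only [Finset.prod_insert ha] using sub_mul_mem_binomialSpan ih a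

theorem zeroCountMean_eq_of_mem {n k : ℕ} (hkn : k ≤ n) {p : ℝ} {P Q : BitLaw n}
    (hP : P ∈ kWiseLaws n k p) (hQ : Q ∈ kWiseLaws n k p) {f : ℕ → ℝ}
    (hf : f ∈ binomialSpan k) : zeroCountMean P f = zeroCountMean Q f := by
  induction hf using Submodule.span_induction with
  | mem f hf =>
    obtain ⟨j, hj, rfl⟩ := hf
    rw [zeroCountMean_choose_of_mem hkn hP hj, zeroCountMean_choose_of_mem hkn hQ hj]
  | zero => simp [zeroCountMean]
  | add f g _ _ hf hg => rw [zeroCountMean_add, zeroCountMean_add, hf, hg]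
  | smul c f _ hf => rw [zeroCountMean_smul, zeroCountMean_smul, hf]

/-- The zeros of the dual polynomial. -/
def dualZeros (k : ℕ) : Finset ℕ := Finset.Icc 1 (k - 2) ∪ {k, k + 1}

theorem card_dualZeros {k : ℕ} (hk : 2 ≤ k) : (dualZeros k).card = k := by
  unfold dualZeros
  rw [Finset.card_union_of_disjoint, Nat.card_Icc, Finset.card_pair (by omega)]
  · omega
  · rw [Finset.disjoint_left]
    intro a ha
    simp only [Finset.mem_Icc, Finset.mem_insert, Finset.mem_singleton] at *
    omega

theorem mem_dualZeros {k z : ℕ} : z ∈ dualZeros k ↔ (1 ≤ z ∧ z ≤ k - 2) ∨ z = k ∨ z = k + 1 := by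
  simp only [dualZeros, Finset.mem_union, Finset.mem_Icc, Finset.mem_insert,
    Finset.mem_singleton]

/-- The roots `k` and `k + 1` are consecutive, so no natural number lies strictly between them. The
other `k - 2` factors are positive beyond `k - 2`; at `0` all are negative, but their number is
even. -/
theorem prod_sub_dualZeros_pos {k : ℕ} (hkeven : Even k) (hk : 2 ≤ k) {z : ℕ}
    (hz : z ∉ dualZeros k) : 0 < ∏ a ∈ dualZeros k, ((z : ℝ) - a) := by
  have hdisj : Disjoint (Finset.Icc 1 (k - 2)) ({k, k + 1} : Finset ℕ) := by
    rw [Finset.disjoint_left]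
    intro a ha
    simp only [Finset.mem_Icc, Finset.mem_insert, Finset.mem_singleton] at *
    omega
  have hsplit : ∏ a ∈ dualZeros k, ((z : ℝ) - a) =
      (∏ a ∈ Finset.Icc 1 (k - 2), ((z : ℝ) - a)) * (((z : ℝ) - k) * ((z : ℝ) - (k + 1))) := by
    rw [dualZeros, Finset.prod_union hdisj, Finset.prod_pair (by omega)]
    push_cast
    rfl
  rw [mem_dualZeros] at hz
  rw [hsplit]
  have h2 : 0 < ((z : ℝ) - k) * ((z : ℝ) - (k + 1)) := by
    rcases Nat.lt_or_ge z k with h | h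
    · have : (z : ℝ) < k := by exact_mod_cast h
      exact mul_pos_of_neg_of_neg (by linarith) (by linarith)
    · have : (k : ℝ) + 1 < z := by
        have : k + 1 < z := by omega
        exact_mod_cast this
      exact mul_pos (by linarith) (by linarith)
  refine mul_pos ?_ h2
  rcases Nat.eq_zero_or_pos z with rfl | hz0
  · have : ∏ a ∈ Finset.Icc 1 (k - 2), (((0 : ℕ) : ℝ) - a) =
        ∏ a ∈ Finset.Icc 1 (k - 2), (a : ℝ) := by
      have h1 : ∀ a ∈ Finset.Icc 1 (k - 2), (((0 : ℕ) : ℝ) - a) = (-1) * (a : ℝ) := by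
        intro a _
        push_cast
        ring
      rw [Finset.prod_congr rfl h1, Finset.prod_mul_distrib, Finset.prod_const, Nat.card_Icc,
        Nat.add_sub_cancel, Even.neg_one_pow (hkeven.tsub even_two), one_mul]
    rw [this]
    refine Finset.prod_pos fun a ha => ?_
    have := (Finset.mem_Icc.mp ha).1
    exact_mod_cast this
  · refine Finset.prod_pos fun a ha => ?_
    have := (Finset.mem_Icc.mp ha).2
    have : (a : ℝ) < z := by
      have : a < z := by omega
      exact_mod_cast this
    linarith

theorem prod_sub_eq_zero {s : Finset ℕ} {z : ℕ} (hz : z ∈ s) : ∏ a ∈ s, ((z : ℝ) - a) = 0 :=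
  Finset.prod_eq_zero hz (sub_self _)

/-- The mean of the dual polynomial dominates the probability of all ones, with equality only if
the number of zeros a.s. lies in the support. -/
theorem probAllOnes_mul_le {n k : ℕ} (hkeven : Even k) (hk : 2 ≤ k) (P : BitLaw n) :
    probAllOnes P * ∏ a ∈ dualZeros k, (((0 : ℕ) : ℝ) - a) ≤
      zeroCountMean P (fun z => ∏ a ∈ dualZeros k, ((z : ℝ) - a)) ∧
    (probAllOnes P * ∏ a ∈ dualZeros k, (((0 : ℕ) : ℝ) - a) =
      zeroCountMean P (fun z => ∏ a ∈ dualZeros k, ((z : ℝ) - a)) →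
      ∀ U : Finset (Fin n), U.card ≠ 0 → U.card ∉ dualZeros k →
        (P : Measure (Fin n → Bool)).real {zerosAt U} = 0) := by
  have hnn : ∀ U : Finset (Fin n), 0 ≤ (P : Measure (Fin n → Bool)).real {zerosAt U} *
      ∏ a ∈ dualZeros k, ((U.card : ℝ) - a) := by
    intro U
    by_cases h : U.card ∈ dualZeros k
    · rw [prod_sub_eq_zero h, mul_zero]
    · exact mul_nonneg measureReal_nonneg (prod_sub_dualZeros_pos hkeven hk h).le
  have hsum : zeroCountMean P (fun z => ∏ a ∈ dualZeros k, ((z : ℝ) - a)) =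
      probAllOnes P * ∏ a ∈ dualZeros k, (((0 : ℕ) : ℝ) - a) +
      ∑ U ∈ Finset.univ.erase (∅ : Finset (Fin n)),
        (P : Measure (Fin n → Bool)).real {zerosAt U} *
          ∏ a ∈ dualZeros k, ((U.card : ℝ) - a) := by
    unfold zeroCountMean
    rw [← Finset.add_sum_erase _ _ (Finset.mem_univ (∅ : Finset (Fin n))), probAllOnes_eq,
      Finset.card_empty]
  rw [hsum]
  refine ⟨le_add_of_nonneg_right (Finset.sum_nonneg fun U _ => hnn U), fun h U hU0 hU => ?_⟩
  have h0 := (Finset.sum_eq_zero_iff_of_nonneg (fun U _ => hnn U)).mp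
    (left_eq_add.mp h) U (Finset.mem_erase.mpr ⟨fun he => hU0 (by simp [he]), Finset.mem_univ _⟩)
  exact (mul_eq_zero.mp h0).resolve_right (prod_sub_dualZeros_pos hkeven hk hU).ne'

/-! ### Exchangeable laws -/

theorem measureReal_ones_zeros_split {n : ℕ} (μ : Measure (Fin n → Bool)) [IsFiniteMeasure μ]
    (S V : Finset (Fin n)) (i : Fin n) :
    μ.real (onesOn S ∩ zerosOn (insert i V)) =
      μ.real (onesOn S ∩ zerosOn V) - μ.real (onesOn (insert i S) ∩ zerosOn V) := by
  have hd : Disjoint (onesOn S ∩ zerosOn (insert i V)) (onesOn (insert i S) ∩ zerosOn V) := by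
    rw [Set.disjoint_left]
    rintro ω ⟨_, h1⟩ ⟨h2, _⟩
    have e1 := h1 i (Finset.mem_insert_self i V)
    have e2 := h2 i (Finset.mem_insert_self i S)
    rw [e1] at e2
    exact Bool.noConfusion e2
  have hu : onesOn S ∩ zerosOn V =
      (onesOn S ∩ zerosOn (insert i V)) ∪ (onesOn (insert i S) ∩ zerosOn V) := by
    ext ω
    simp only [onesOn, zerosOn, Set.mem_inter_iff, Set.mem_union, Set.mem_ofPred_eq,
      Finset.forall_mem_insert]
    cases ω i <;> simp
  rw [hu, measureReal_union hd (Set.toFinite _).measurableSet, add_sub_cancel_right]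

/-- Exchangeability speaks only of ones; prescribed zeros are removed one at a time by
`measureReal_ones_zeros_split`. -/
theorem Exchangeable.measureReal_eq {n : ℕ} {P : BitLaw n} (hP : Exchangeable P)
    (U : Finset (Fin n)) : ∀ S S' U' : Finset (Fin n), Disjoint S U → Disjoint S' U' →
      S.card = S'.card → U.card = U'.card →
      (P : Measure (Fin n → Bool)).real (onesOn S ∩ zerosOn U) =
        (P : Measure (Fin n → Bool)).real (onesOn S' ∩ zerosOn U') := by
  induction U using Finset.induction_on with
  | empty =>
    intro S S' U' _ _ hS hU
    obtain rfl := Finset.card_eq_zero.mp hU.symm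
    simpa [zerosOn] using hP S S' hS
  | insert i V hi ih =>
    intro S S' U' hd hd' hS hU
    rw [Finset.card_insert_of_notMem hi] at hU
    obtain ⟨i', V', hi', rfl, hV'⟩ := Finset.card_eq_succ.mp hU.symm
    rw [Finset.disjoint_insert_right] at hd hd'
    rw [measureReal_ones_zeros_split, measureReal_ones_zeros_split,
      ih S S' V' hd.2 hd'.2 hS hV'.symm]
    rw [ih (insert i S) (insert i' S') V' (Finset.disjoint_insert_left.mpr ⟨hi, hd.2⟩)
      (Finset.disjoint_insert_left.mpr ⟨hi', hd'.2⟩)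
      (by rw [Finset.card_insert_of_notMem hd.1, Finset.card_insert_of_notMem hd'.1, hS])
      hV'.symm]

theorem singleton_zerosAt_eq {n : ℕ} (U : Finset (Fin n)) :
    ({zerosAt U} : Set (Fin n → Bool)) = onesOn Uᶜ ∩ zerosOn U := by
  ext ω
  simp only [Set.mem_singleton_iff, funext_iff, zerosAt, onesOn, zerosOn, Set.mem_inter_iff,
    Set.mem_ofPred_eq, Finset.mem_compl]
  constructor
  · intro h
    exact ⟨fun i hi => by simp [h i, hi], fun i hi => by simp [h i, hi]⟩
  · rintro ⟨h1, h2⟩ i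
    by_cases hi : i ∈ U
    · simp [h2 i hi, hi]
    · simp [h1 i hi, hi]

theorem Exchangeable.measureReal_zerosAt_eq {n : ℕ} {P : BitLaw n} (hP : Exchangeable P)
    {U U' : Finset (Fin n)} (h : U.card = U'.card) :
    (P : Measure (Fin n → Bool)).real {zerosAt U} =
      (P : Measure (Fin n → Bool)).real {zerosAt U'} := by
  rw [singleton_zerosAt_eq, singleton_zerosAt_eq]
  exact hP.measureReal_eq U _ _ _ disjoint_compl_left disjoint_compl_left
    (by rw [Finset.card_compl, Finset.card_compl, h]) h

theorem atomProb_eq {n : ℕ} (P : BitLaw n) {i : ℕ} (hi : i ≤ n) :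
    ∃ U : Finset (Fin n), U.card = i ∧
      atomProb P (n - i) = (P : Measure (Fin n → Bool)).real {zerosAt U} := by
  refine ⟨(Finset.univ.filter (fun j : Fin n => (j : ℕ) < n - i))ᶜ, ?_, ?_⟩
  · rw [Finset.card_compl, Fin.card_filter_val_lt, Fintype.card_fin]
    omega
  · unfold atomProb
    congr 1
    ext ω
    simp only [Set.mem_ofPred_eq, Set.mem_singleton_iff, funext_iff, zerosAt]
    refine forall_congr' fun j => ?_
    by_cases hj : n - i ≤ (j : ℕ)
    · simp [hj, show n ≤ j + i by omega]
    · simp [hj, show j + i < n by omega, not_le.mp hj]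

theorem Exchangeable.measureReal_zerosAt {n : ℕ} {P : BitLaw n} (hP : Exchangeable P)
    (U : Finset (Fin n)) :
    (P : Measure (Fin n → Bool)).real {zerosAt U} = atomProb P (n - U.card) := by
  obtain ⟨V, hV, h⟩ := atomProb_eq P (i := U.card) (by simpa using Finset.card_le_univ U)
  rw [h]
  exact hP.measureReal_zerosAt_eq hV.symm

/-! ### Construction of the law and its optimality -/

theorem sum_univ_apply_card {n : ℕ} (f : ℕ → ℝ) :
    ∑ U : Finset (Fin n), f U.card = ∑ i ∈ Finset.range (n + 1), (n.choose i : ℝ) * f i := by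
  have := Finset.sum_powerset_apply_card f (x := (Finset.univ : Finset (Fin n)))
  simpa [nsmul_eq_mul] using this

theorem sum_superset_apply_card {n : ℕ} (f : ℕ → ℝ) (T : Finset (Fin n)) :
    ∑ U : Finset (Fin n), (if T ⊆ U then f U.card else 0) =
      ∑ m ∈ Finset.range (n - T.card + 1), ((n - T.card).choose m : ℝ) * f (T.card + m) := by
  have h := Finset.sum_powerset_apply_card (fun m => f (T.card + m)) (x := Tᶜ)
  rw [Finset.card_compl, Fintype.card_fin] at h
  simp only [nsmul_eq_mul] at h
  rw [← h, ← Finset.sum_filter]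
  refine Finset.sum_nbij' (fun U => U \ T) (fun V => T ∪ V) ?_ ?_ ?_ ?_ ?_
  · intro U _
    rw [Finset.mem_powerset]
    intro a ha
    simpa using (Finset.mem_sdiff.mp ha).2
  · intro V _
    simp
  · intro U hU
    exact Finset.union_sdiff_of_subset (Finset.mem_filter.mp hU).2
  · intro V hV
    rw [Finset.mem_powerset, Finset.subset_compl_iff_disjoint_right] at hV
    exact Finset.union_sdiff_cancel_left hV.symm
  · intro U hU
    have hU := (Finset.mem_filter.mp hU).2
    rw [Finset.card_sdiff_of_subset hU, Nat.add_sub_cancel' (Finset.card_le_card hU)]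

/-- A nonnegative function of the number of zeros with total mass one defines a law. -/
theorem exists_bitLaw {n : ℕ} (f : ℕ → ℝ) (hf : ∀ i ≤ n, 0 ≤ f i)
    (h1 : ∑ U : Finset (Fin n), f U.card = 1) :
    ∃ P : BitLaw n, ∀ U, (P : Measure (Fin n → Bool)).real {zerosAt U} = f U.card := by
  have hc : ∀ U : Finset (Fin n), 0 ≤ f U.card := fun U =>
    hf _ (by simpa using Finset.card_le_univ U)
  let μ : Measure (Fin n → Bool) :=
    ∑ U : Finset (Fin n), ENNReal.ofReal (f U.card) • Measure.dirac (zerosAt U)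
  have happly : ∀ A, μ A = ∑ U : Finset (Fin n),
      ENNReal.ofReal (f U.card) * A.indicator 1 (zerosAt U) := by
    intro A
    simp only [μ, Measure.coe_finsetSum, Finset.sum_apply, Measure.smul_apply, smul_eq_mul]
    refine Finset.sum_congr rfl fun U _ => ?_
    rw [Measure.dirac_apply' _ (Set.toFinite _).measurableSet]
  have hprob : IsProbabilityMeasure μ := by
    constructor
    rw [happly]
    simp only [Set.indicator_univ, Pi.one_apply, mul_one]
    rw [← ENNReal.ofReal_sum_of_nonneg (fun U _ => hc U), h1, ENNReal.ofReal_one]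
  refine ⟨⟨μ, hprob⟩, fun U => ?_⟩
  change (μ {zerosAt U}).toReal = _
  rw [happly, Finset.sum_eq_single U]
  · simp [hc U]
  · intro V _ hV
    have : zerosAt V ≠ zerosAt U := fun h => hV ((zerosAt_bijective n).1 h)
    simp [this]
  · simp

theorem exists_secondLastLaw {n k : ℕ} (hkeven : Even k) (hk : 2 ≤ k) (hkn : k + 2 ≤ n) {p : ℝ}
    (hnn : ∀ i ≤ n, 0 ≤ secondLastAtom n k p i) :
    ∃ P : BitLaw n, P ∈ kWiseLaws n k p ∧ Exchangeable P ∧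
      ∀ U, (P : Measure (Fin n → Bool)).real {zerosAt U} = secondLastAtom n k p U.card := by
  obtain ⟨P, hP⟩ := exists_bitLaw (n := n) (secondLastAtom n k p) hnn (by
    have := sum_choose_mul_secondLastAtom hkeven hk hkn p (Nat.zero_le k)
    rw [sum_univ_apply_card]
    simpa using this)
  refine ⟨P, mem_kWiseLaws_of_zerosOn (by omega) fun T hT => ?_, ?_, hP⟩
  · rw [measureReal_zerosOn_eq_sum]
    simp only [hP]
    rw [sum_superset_apply_card, sum_choose_mul_secondLastAtom hkeven hk hkn p hT]
  · have key : ∀ S : Finset (Fin n), (P : Measure (Fin n → Bool)).real (onesOn S) =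
        ∑ i ∈ Finset.range (n - S.card + 1),
          ((n - S.card).choose i : ℝ) * secondLastAtom n k p i := by
      intro S
      classical
      rw [measureReal_eq_sum_zerosAt]
      have h := Finset.sum_powerset_apply_card (secondLastAtom n k p) (x := Sᶜ)
      rw [Finset.card_compl, Fintype.card_fin] at h
      simp only [nsmul_eq_mul] at h
      rw [← h, ← Finset.sum_filter]
      simp only [hP]
      refine Finset.sum_congr ?_ fun _ _ => rfl
      ext U
      simp only [onesOn, zerosAt, Finset.mem_filter, Finset.mem_univ, true_and,
        Finset.mem_powerset, Finset.subset_iff, Set.mem_ofPred_eq, decide_eq_true_eq,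
        Finset.mem_compl]
      exact ⟨fun h i hi hS => h i hS hi, fun h i hS hi => h hi hS⟩
    intro S T hST
    rw [key, key, hST]

theorem secondLastAtom_zero {n k : ℕ} (hkeven : Even k) (hk : 2 ≤ k) (hkn : k + 2 ≤ n) (p : ℝ) :
    secondLastAtom n k p 0 = secondLastValue n k p := by
  rw [secondLastAtom_eq hkeven hk hkn p (by omega)]
  unfold secondLastValue
  simp
  ring

theorem secondLastFormulas_of_nonneg {n k : ℕ} (hkeven : Even k) (hk : 2 ≤ k) (hkn : k + 2 ≤ n)
    {p : ℝ} (hnn : ∀ i ≤ n, 0 ≤ secondLastAtom n k p i) : SecondLastFormulas n k p := by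
  obtain ⟨Q, hQ, hQex, hQatom⟩ := exists_secondLastLaw hkeven hk hkn hnn
  have hspan : (fun z : ℕ => ∏ a ∈ dualZeros k, ((z : ℝ) - a)) ∈ binomialSpan k := by
    simpa only [card_dualZeros hk] using prod_sub_mem_binomialSpan (dualZeros k)
  have h0pos : 0 < ∏ a ∈ dualZeros k, (((0 : ℕ) : ℝ) - a) :=
    prod_sub_dualZeros_pos hkeven hk (by rw [mem_dualZeros]; omega)
  have hQ0 : probAllOnes Q = secondLastValue n k p := by
    rw [probAllOnes_eq, hQatom, Finset.card_empty, secondLastAtom_zero hkeven hk hkn]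
  have hoff : ∀ i ≤ n, i ≠ 0 → i ∉ dualZeros k → secondLastAtom n k p i = 0 := by
    intro i hi h0 hz
    unfold secondLastAtom
    rw [if_neg]
    rw [mem_secondLastSupport_iff hk hkn hi]
    rw [mem_dualZeros] at hz
    omega
  have hQdual : probAllOnes Q * ∏ a ∈ dualZeros k, (((0 : ℕ) : ℝ) - a) =
      zeroCountMean Q (fun z => ∏ a ∈ dualZeros k, ((z : ℝ) - a)) := by
    unfold zeroCountMean
    rw [Finset.sum_eq_single (∅ : Finset (Fin n)), probAllOnes_eq, Finset.card_empty]
    · intro U _ hU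
      by_cases hz : U.card ∈ dualZeros k
      · exact mul_eq_zero_of_right _ (prod_sub_eq_zero hz)
      · rw [hQatom, hoff _ (by simpa using Finset.card_le_univ U)
          (fun h => hU (Finset.card_eq_zero.mp h)) hz, zero_mul]
    · simp
  have hle : ∀ P ∈ kWiseLaws n k p, probAllOnes P ≤ probAllOnes Q := by
    intro P hP
    have h := (probAllOnes_mul_le hkeven hk P).1
    rw [zeroCountMean_eq_of_mem (by omega) hP hQ hspan, ← hQdual] at h
    exact le_of_mul_le_mul_right h h0pos
  have hmax : maxAllOnes n k p = probAllOnes Q :=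
    IsGreatest.csSup_eq ⟨⟨Q, hQ, rfl⟩, by rintro _ ⟨P, hP, rfl⟩; exact hle P hP⟩
  refine ⟨hmax.trans hQ0, ⟨Q, hQex, hQ, hmax.symm⟩, ?_⟩
  rintro P hPex ⟨hP, hPmax⟩ i hi
  -- Complementary slackness: an optimal law attains equality in the dual bound, so it has no mass
  -- off the support.
  have hzero := (probAllOnes_mul_le hkeven hk P).2 (by
    rw [hPmax, hmax, hQdual, zeroCountMean_eq_of_mem (by omega) hP hQ hspan])
  have hPoff : ∀ j ≤ n, j ≠ 0 → j ∉ dualZeros k → atomProb P (n - j) = 0 := by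
    intro j hj h0 hz
    obtain ⟨U, rfl, hU⟩ := atomProb_eq P hj
    rw [hU]
    exact hzero U h0 hz
  -- The product over the other `k` support points has degree `k`, so its mean agrees under `P` and
  -- `Q`, and it isolates the atom at `i`.
  by_cases hsupp : i ∈ insert 0 (dualZeros k)
  · have hspan' : (fun z : ℕ => ∏ a ∈ (insert 0 (dualZeros k)).erase i, ((z : ℝ) - a)) ∈
        binomialSpan k := by
      have := prod_sub_mem_binomialSpan ((insert 0 (dualZeros k)).erase i)
      rw [Finset.card_erase_of_mem hsupp, Finset.card_insert_of_notMem
        (by rw [mem_dualZeros]; omega), card_dualZeros hk] at this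
      simpa using this
    have hmean : ∀ R : BitLaw n, ∀ g : ℕ → ℝ,
        (∀ U, (R : Measure (Fin n → Bool)).real {zerosAt U} = g U.card) →
        (∀ j ≤ n, j ≠ 0 → j ∉ dualZeros k → g j = 0) →
        zeroCountMean R (fun z => ∏ a ∈ (insert 0 (dualZeros k)).erase i, ((z : ℝ) - a)) =
          (n.choose i : ℝ) * (g i *
            ∏ a ∈ (insert 0 (dualZeros k)).erase i, ((i : ℝ) - a)) := by
      intro R g hR hg
      unfold zeroCountMean
      simp only [hR]
      rw [sum_univ_apply_card (fun z => g z *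
        ∏ a ∈ (insert 0 (dualZeros k)).erase i, ((z : ℝ) - a)), Finset.sum_eq_single i]
      · intro j hj hji
        by_cases hjs : j ∈ insert 0 (dualZeros k)
        · rw [prod_sub_eq_zero (Finset.mem_erase.mpr ⟨hji, hjs⟩), mul_zero, mul_zero]
        · rw [Finset.mem_insert, not_or] at hjs
          rw [hg j (Nat.lt_succ_iff.mp (Finset.mem_range.mp hj)) hjs.1 hjs.2, zero_mul, mul_zero]
      · intro h
        exact absurd (Finset.mem_range.mpr (Nat.lt_succ_iff.mpr hi)) h
    have e := zeroCountMean_eq_of_mem (by omega) hP hQ hspan'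
    rw [hmean P (fun j => atomProb P (n - j)) hPex.measureReal_zerosAt hPoff,
      hmean Q _ hQatom hoff] at e
    have hne : ∏ a ∈ (insert 0 (dualZeros k)).erase i, ((i : ℝ) - a) ≠ 0 := by
      rw [Finset.prod_ne_zero_iff]
      intro a ha
      rw [sub_ne_zero]
      exact_mod_cast (Finset.ne_of_mem_erase ha).symm
    have hch : (n.choose i : ℝ) ≠ 0 := by exact_mod_cast (Nat.choose_pos hi).ne'
    exact mul_right_cancel₀ hne (mul_left_cancel₀ hch e)
  · rw [Finset.mem_insert, not_or] at hsupp
    rw [hPoff i hi hsupp.1 hsupp.2, hoff i hi hsupp.1 hsupp.2]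

/-! ### Positivity of the atoms and the least left endpoint -/

theorem SecondLastFormulas.secondLastAtom_nonneg {n k : ℕ} {p : ℝ} (h : SecondLastFormulas n k p)
    {i : ℕ} (hi : i ≤ n) : 0 ≤ secondLastAtom n k p i := by
  obtain ⟨_, ⟨P, hex, hopt⟩, huniq⟩ := h
  rw [← huniq P hex hopt i hi]
  exact measureReal_nonneg

theorem secondLastAtom_eq_reducedAtom {n k : ℕ} (hkeven : Even k) (hk : 2 ≤ k) (hkn : k + 2 ≤ n)
    (p : ℝ) {l : ℕ} (hl : 1 ≤ l) (hlk : l ≤ k) :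
    secondLastAtom n k p (k - l) = (1 - p) ^ (k - l) * reducedAtom (n - k) l (1 - p) := by
  obtain ⟨i, rfl⟩ := Nat.exists_eq_add_of_le' hlk
  have hs : (-1 : ℝ) ^ i = (-1) ^ l := by
    have h : (-1 : ℝ) ^ i * (-1) ^ l = 1 := by rw [← pow_add, hkeven.neg_one_pow]
    rcases neg_one_pow_eq_or ℝ l with hl | hl <;> rw [hl] at h ⊢ <;> linarith
  have hx : (1 - p) ^ (i + l - 1) = (1 - p) ^ i * (1 - p) ^ (l - 1) := by
    rw [← pow_add]
    congr 1
    omega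
  rw [Nat.add_sub_cancel, secondLastAtom_eq hkeven hk hkn p (by omega), hs, hx, bonferroni_one]
  unfold reducedAtom
  rw [show n - (i + l) + l = n - i by omega, show i + l + 1 - i = l + 1 by omega,
    show ((i + l : ℕ) : ℤ) - i = l by push_cast; ring]
  push_cast
  ring

theorem secondLastAtom_self {n k : ℕ} (hkeven : Even k) (hk : 2 ≤ k) (hkn : k + 2 ≤ n) (p : ℝ) :
    secondLastAtom n k p k =
      (1 - p) ^ (k - 1) * (2 / ((n : ℝ) - k + 1) - (1 - p)) := by
  obtain ⟨d, rfl⟩ := Nat.exists_eq_add_of_le (show k ≤ n by omega)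
  have hd : (0 : ℝ) < d := by
    have : 0 < d := by omega
    exact_mod_cast this
  obtain ⟨j, rfl⟩ := Nat.exists_eq_add_of_le' (show 1 ≤ k by omega)
  have hb : bonferroni (j + 1 + d - (j + 1)) (((j + 1 : ℕ) : ℤ) - ((j + 1 : ℕ) : ℤ)) (1 - p) =
      1 := by simp [bonferroni]
  rw [secondLastAtom_eq hkeven hk hkn p (by omega), hb, bonferroni_one, hkeven.neg_one_pow,
    show j + 1 + d - (j + 1) = d by omega, show j + 1 + 1 - (j + 1) = 1 by omega,
    cast_choose_two_succ, Nat.choose_one_right, Nat.add_sub_cancel, pow_succ]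
  push_cast
  rw [show (j : ℝ) + 1 + d - (j + 1) + 1 = d + 1 by ring]
  field_simp
  ring

theorem secondLastAtom_succ {n k : ℕ} (hkeven : Even k) (hk : 2 ≤ k) (hkn : k + 2 ≤ n) (p : ℝ) :
    secondLastAtom n k p (k + 1) = (1 - p) ^ (k - 1) / ((n - k + 1).choose 2 : ℝ) *
      (((n : ℝ) - k + 1) * (1 - p) - 1) := by
  have hb : bonferroni (n - (k + 1)) ((k : ℤ) - ((k + 1 : ℕ) : ℤ)) (1 - p) = 0 := by
    simp [bonferroni]
  rw [secondLastAtom_eq hkeven hk hkn p le_rfl, hb, bonferroni_one,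
    hkeven.add_one.neg_one_pow, Nat.sub_self, Nat.choose_zero_right]
  push_cast [show k ≤ n by omega]
  ring

theorem secondLastAtom_nonneg_of {n k : ℕ} (hkeven : Even k) (hk : 2 ≤ k) (hkn : k + 2 ≤ n)
    {p : ℝ} (h1 : 1 ≤ ((n : ℝ) - k + 1) * (1 - p)) (h2 : ((n : ℝ) - k + 1) * (1 - p) ≤ 2)
    (h : ∀ l, 2 ≤ l → l ≤ k → 0 ≤ reducedAtom (n - k) l (1 - p)) :
    ∀ i ≤ n, 0 ≤ secondLastAtom n k p i := by
  intro i hi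
  have hd : (0 : ℝ) < (n : ℝ) - k + 1 := by
    have : (k : ℝ) ≤ n := by exact_mod_cast (show k ≤ n by omega)
    linarith
  have hx : 0 < 1 - p := pos_of_mul_pos_right (zero_lt_one.trans_le h1) hd.le
  rcases Nat.lt_or_ge (k + 1) i with hik | hik
  · exact (secondLastAtom_of_gt hk hkn p hik hi).ge
  rcases hik.eq_or_lt with rfl | hik
  · rw [secondLastAtom_succ hkeven hk hkn]
    exact mul_nonneg (by positivity) (by linarith)
  rcases (Nat.lt_succ_iff.mp hik).eq_or_lt with rfl | hik
  · rw [secondLastAtom_self hkeven hk hkn]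
    refine mul_nonneg (by positivity) (sub_nonneg.mpr ?_)
    rw [le_div_iff₀ hd]
    linarith
  rcases Nat.lt_or_ge i (k - 1) with hik' | hik'
  · have := secondLastAtom_eq_reducedAtom hkeven hk hkn p (l := k - i) (by omega) (by omega)
    rw [Nat.sub_sub_self hik.le] at this
    rw [this]
    exact mul_nonneg (by positivity) (h _ (by omega) (by omega))
  · unfold secondLastAtom
    rw [if_neg]
    rw [mem_secondLastSupport_iff hk hkn hi]
    omega

theorem isLeast_secondLastEndpoints_two {n : ℕ} (hn : 4 ≤ n) :
    IsLeast (secondLastEndpoints n 2) (1 - 2 / ((n : ℝ) - 1)) := by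
  have hn' : (4 : ℝ) ≤ n := by exact_mod_cast hn
  have hpos : (0 : ℝ) < n - 1 := by linarith
  have hN : (n : ℝ) - ((2 : ℕ) : ℝ) + 1 = n - 1 := by push_cast; ring
  refine ⟨⟨?_, fun p hp => ?_⟩, fun q hq => ?_⟩
  · unfold pBarOne
    rw [hN]
    have : 1 / ((n : ℝ) - 1) < 2 / (n - 1) := div_lt_div_of_pos_right (by norm_num) hpos
    linarith
  · unfold pBarOne at hp
    rw [hN] at hp
    have h1 : 1 / ((n : ℝ) - 1) ≤ 1 - p := by linarith [hp.2]
    have h2 : 1 - p ≤ 2 / ((n : ℝ) - 1) := by linarith [hp.1]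
    rw [div_le_iff₀ hpos] at h1
    rw [le_div_iff₀ hpos] at h2
    refine secondLastFormulas_of_nonneg even_two le_rfl hn
      (secondLastAtom_nonneg_of even_two le_rfl hn (by rw [hN]; linarith) (by rw [hN]; linarith) ?_)
    intro l hl hl2
    obtain rfl : l = 2 := by omega
    exact (reducedAtom_two_pos (n - 2) (by omega) _).le
  -- Below the threshold the atom with `k = 2` zeros would be negative.
  · by_contra hlt
    rw [not_le] at hlt
    have hnn := (hq.2 q ⟨le_rfl, hq.1.le⟩).secondLastAtom_nonneg (show 2 ≤ n by omega)
    rw [secondLastAtom_self even_two le_rfl hn, hN] at hnn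
    have h2 : 0 < 2 / ((n : ℝ) - 1) := by positivity
    have := mul_neg_of_pos_of_neg (show (0 : ℝ) < (1 - q) ^ (2 - 1) from pow_pos (by linarith) _)
      (show 2 / ((n : ℝ) - 1) - (1 - q) < 0 by linarith)
    linarith

theorem intervalCubic_eq_reducedAtom {n k : ℕ} (hkn : k + 2 ≤ n) (x : ℝ) :
    intervalCubic n k x = reducedAtom (n - k) 3 x := by
  rw [intervalCubic_eq, reducedAtom_three _ (by omega)]

theorem isLeast_secondLastEndpoints_of_zero {n k : ℕ} (hkeven : Even k) (hk : 4 ≤ k)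
    (hkn : k + 2 ≤ n) {x : ℝ} (h1 : 1 < ((n - k : ℕ) + 1) * x)
    (h2 : (2 * (n - k : ℕ) + 5) * x ≤ 4) (h0 : reducedAtom (n - k) 3 x = 0) :
    IsLeast (secondLastEndpoints n k) (1 - x) := by
  have hcast : ((n - k : ℕ) : ℝ) = n - k := Nat.cast_sub (by omega)
  have hanti := reducedAtom_three_strictAnti (n - k) (by omega)
  have hd : (0 : ℝ) < (n : ℝ) - k + 1 := by rw [← hcast]; positivity
  have hx : 0 < x := by
    rw [hcast] at h1
    exact pos_of_mul_pos_right (zero_lt_one.trans h1) hd.le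
  refine ⟨⟨?_, fun p hp => ?_⟩, fun q hq => ?_⟩
  · unfold pBarOne
    rw [hcast] at h1
    have : 1 / ((n : ℝ) - k + 1) < x := by
      rw [div_lt_iff₀ hd]
      linarith
    linarith
  · unfold pBarOne at hp
    have g1 : 1 / ((n : ℝ) - k + 1) ≤ 1 - p := by linarith [hp.2]
    have g2 : 1 - p ≤ x := by linarith [hp.1]
    rw [div_le_iff₀ hd] at g1
    have g3 : (2 * ((n - k : ℕ) : ℝ) + 5) * (1 - p) ≤ 4 :=
      (mul_le_mul_of_nonneg_left g2 (by positivity)).trans h2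
    have g4 : 0 ≤ 1 - p := by
      by_contra hneg
      nlinarith
    refine secondLastFormulas_of_nonneg hkeven (by omega) hkn
      (secondLastAtom_nonneg_of hkeven (by omega) hkn (by linarith) ?_ fun l hl _ => ?_)
    · rw [hcast] at g3
      linarith
    · refine reducedAtom_nonneg (n - k) (by omega) (1 - p) ?_ g3 ?_ l hl
      · rw [hcast]
        linarith
      · rw [← h0]
        exact hanti.antitone g2
  -- Below the threshold the atom with `k - 3` zeros would be negative; it exists because `k ≥ 4`.
  · by_contra hlt
    rw [not_le] at hlt
    have hnn := (hq.2 q ⟨le_rfl, hq.1.le⟩).secondLastAtom_nonneg (show k - 3 ≤ n by omega)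
    rw [secondLastAtom_eq_reducedAtom hkeven (by omega) hkn q (by omega) (by omega)] at hnn
    have hneg := hanti (show x < 1 - q by linarith)
    rw [h0] at hneg
    have := mul_neg_of_pos_of_neg (show (0 : ℝ) < (1 - q) ^ (k - 3) from pow_pos (by linarith) _)
      hneg
    linarith

theorem exists_isLeast_secondLastEndpoints {n k : ℕ} (hkeven : Even k) (hk : 4 ≤ k)
    (hkn : k + 2 ≤ n) :
    ∃ r ∈ Set.Icc (1 - 2 / ((n : ℝ) - (k : ℝ) + 1)) (1 - 1 / ((n : ℝ) - (k : ℝ) + 1)),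
      intervalCubic n k (1 - r) = 0 ∧
      (∀ s ∈ Set.Icc (1 - 2 / ((n : ℝ) - (k : ℝ) + 1)) (1 - 1 / ((n : ℝ) - (k : ℝ) + 1)),
        intervalCubic n k (1 - s) = 0 → s = r) ∧
      IsLeast (secondLastEndpoints n k) r := by
  obtain ⟨x, h1, h2, h0⟩ := exists_reducedAtom_three_eq_zero (n - k) (by omega)
  have hleast := isLeast_secondLastEndpoints_of_zero hkeven hk hkn h1 h2 h0
  have hcast : ((n - k : ℕ) : ℝ) = n - k := Nat.cast_sub (by omega)
  have hd : (0 : ℝ) < (n : ℝ) - k + 1 := by rw [← hcast]; positivity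
  rw [hcast] at h1 h2
  have hx : 0 < x := pos_of_mul_pos_right (zero_lt_one.trans h1) hd.le
  refine ⟨1 - x, ⟨?_, hleast.1.1.le⟩, ?_, fun s _ hs => ?_, hleast⟩
  · have : x ≤ 2 / ((n : ℝ) - k + 1) := by
      rw [le_div_iff₀ hd]
      linarith
    linarith
  · rw [intervalCubic_eq_reducedAtom hkn, sub_sub_cancel, h0]
  · rw [intervalCubic_eq_reducedAtom hkn, ← h0] at hs
    have := (reducedAtom_three_strictAnti (n - k) (by omega)).injective hs
    linarith

theorem theorem5 (n k : ℕ) (hkeven : Even k) (hk : 2 ≤ k) (hkn : k + 2 ≤ n) :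
    (∃ q : ℝ, q < pBarOne n k ∧
      ∀ p ∈ Set.Icc q (pBarOne n k), SecondLastFormulas n k p) ∧
    (k = 2 → IsLeast (secondLastEndpoints n k) (1 - 2 / ((n : ℝ) - 1))) ∧
    (4 ≤ k → ∃ r ∈ Set.Icc (1 - 2 / ((n : ℝ) - (k : ℝ) + 1)) (1 - 1 / ((n : ℝ) - (k : ℝ) + 1)),
      intervalCubic n k (1 - r) = 0 ∧
      (∀ s ∈ Set.Icc (1 - 2 / ((n : ℝ) - (k : ℝ) + 1)) (1 - 1 / ((n : ℝ) - (k : ℝ) + 1)),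
        intervalCubic n k (1 - s) = 0 → s = r) ∧
      IsLeast (secondLastEndpoints n k) r) := by
  refine ⟨?_, ?_, fun h4 => exists_isLeast_secondLastEndpoints hkeven h4 hkn⟩
  · rcases hk.eq_or_lt with rfl | h2
    · exact ⟨_, (isLeast_secondLastEndpoints_two hkn).1⟩
    · have h4 : 4 ≤ k := by
        obtain ⟨m, rfl⟩ := hkeven
        omega
      obtain ⟨r, _, _, _, hr⟩ := exists_isLeast_secondLastEndpoints hkeven h4 hkn
      exact ⟨r, hr.1⟩
  · rintro rfl
    exact isLeast_secondLastEndpoints_two hkn
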